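/- **Setting.** Let $\Sigma$ be a real-analytic 3-manifold (Hausdorff, second countable), $\mathcal A$ the set of smooth $su(2)$-valued one-forms $A=A^i\tau_i$ on $\Sigma$ with $\tau_i=\frac i2\sigma_i$, and $h_e[A]\in SU(2)$ the holonomy of $A$ along a compact embedded oriented analytic arc (edge) $e$. A function $c$ on $\mathcal A$ is *cylindrical* if $c[A]=g(h_{e_1}[A],\dots,h_{e_n}[A])$ for finitely many edges and a continuous function $g$ on $SU(2)^n$; $\mathrm{Cyl}$ is the closure of the cylindrical functions in the supremum norm, a commutative unital $C^*$-algebra, $\mathrm{Cyl}^\infty$ is the set of those $c$ with $g$ smooth, and $\overline{\mathcal A}$ is the spectrum of $\mathrm{Cyl}$, so that each $c\in\mathrm{Cyl}$ is also a continuous function on $\overline{\mathcal A}$. Surfaces $S\subset\Sigma$ are oriented, two-dimensional and analytic (near each point of its closure $S$ lies in an analytic hypersurface; the empty surface is allowed); a co-vector field $f=(f_1,f_2,f_3)$ on $S$ is a smooth map $S\to\mathbb R^3$. For $l>0$ and $c=g(h_{e_1},\dots,h_{e_n})\in\mathrm{Cyl}^\infty$, where the edges meet $S$ only in endpoints or tangentially,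 put $$X_{S,f}[c]=\frac{i\,l^2}{2}\sum_{p\in S}\ \sum_{e_p}\kappa(e_p)\,f_i(p)\,X^i_{e_p}[g],$$ the inner sum being over the edges $e_p$ starting or ending at $p$; $\kappa(e_p)=1,-1,0$ if $e_p$ lies above, below, or tangential to $S$ near $p$; $f_iX^i_{e_p}$ is the derivative at $s=0$ of $h_{e_p}\mapsto h_{e_p}e^{sf_i\tau_i}$ if $e_p$ starts at $p$, and of $h_{e_p}\mapsto e^{-sf_i\tau_i}h_{e_p}$ if $e_p$ ends at $p$. A *representation of $\mathfrak A$* (the $*$-algebra generated by $\mathrm{Cyl}$ and the $X_{S,f}=X_{S,f}^*$) on a Hilbert space $\mathcal H$ means here: a unital $*$-homomorphism $\pi:\mathrm{Cyl}\to B(\mathcal H)$, together with symmetric, in general unbounded, operators $\pi(E_{S,f})$ for all surfaces $S$ and co-vector fields $f$ on $S$, on a common dense domain $D$ which is invariant under $\pi(\mathrm{Cyl}^\infty)$, such that on $D$ one has $[\pi(E_{S,f}),\pi(c)]=\pi(X_{S,f}[c])$ for $c\in\mathrm{Cyl}^\infty$, and such that $\Phi_{S,f}=\pi(E_{S,f})$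 satisfies the linear relations $$\text{(rep)}\quad \Phi_{S,f+f''}=\Phi_{S,f}+\Phi_{S,f''},\quad \Phi_{S,rf}=r\,\Phi_{S,f}\ (r\in\mathbb R),\quad \Phi_{S,f}+\Phi_{S',f'}=\Phi_{S\setminus S',f}+\Phi_{S'\setminus S,f'}+\Phi_{S\cap S',f\pm f'},$$ the last one whenever the three sets on the right are surfaces; $S\cap S'$ has the orientation of $S$, and the sign is the relative orientation of $S$ and $S'$. **Proposition 2.** Let $(\mu_\nu)_{\nu\in N}$ be a family of finite regular Borel measures on $\overline{\mathcal A}$, and for all $S,f$ and $\iota,\nu\in N$ let $F^{\iota\nu}_{S,f}\in L^2(\overline{\mathcal A},\mu_\iota)$, such that * (dom) $\sum_\iota\|F^{\iota\nu}_{S,f}\|^2_{L^2(\mu_\iota)}<\infty$ for all $S,f,\nu$; * (rep) for all $\iota,\nu$ the relations (rep) hold for $\Phi_{S,f}=F^{\iota\nu}_{S,f}$; * (div) for all $S,f,\iota$ and $c,c'\in\mathrm{Cyl}^\infty$, with the inner products of $L^2(\mu_\iota)$, $$\langle X_{S,f}[c],c'\rangle-\langle c,X_{S,f}[c']\rangle=2i\,\langle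 c,\operatorname{Im}(F^{\iota\iota}_{S,f})\,c'\rangle,$$ and $F^{\nu\iota}_{S,f}\,d\mu_\nu=\overline{F^{\iota\nu}_{S,f}}\,d\mu_\iota$ for $\iota\ne\nu$. Let $\mathcal H=\bigoplus_\nu L^2(\overline{\mathcal A},\mu_\nu)$, let $I_\nu$ be the inclusion of the $\nu$-th summand, and let $\mathfrak h$ be the linear span of all $I_\nu(c)$, $\nu\in N$, $c\in\mathrm{Cyl}^\infty$. Then $X_{S,f}[c]\in\mathrm{Cyl}$ exists for each $c\in\mathrm{Cyl}^\infty$, and there is a representation $\pi$ of $\mathfrak A$ on $\mathcal H$ in which $\mathrm{Cyl}$ acts by multiplication, $\pi(c)\bigoplus_\nu v_\nu=\bigoplus_\nu c\,v_\nu$, in which all $\pi(E_{S,f})$ are defined on $D=\mathfrak h$ (so that $\mathfrak h\subset\operatorname{dom}\pi(E_{S,f})$, which is Assumption 1), and $$\pi(E_{S,f})\,I_\nu(c)=I_\nu\big(X_{S,f}[c]\big)+\sum_\iota I_\iota\big(c\,F^{\iota\nu}_{S,f}\big)\qquad(\nu\in N,\ c\in\mathrm{Cyl}^\infty).$$ 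-/

import Mathlib

open MeasureTheory Filter Topology
open scoped Manifold ContDiff ENNReal

noncomputable section

namespace LQG

section SU2

/-- The group `SU(2)`. -/
abbrev SU2 : Type := Matrix.specialUnitaryGroup (Fin 2) ℂ

/-- `∑ᵢ xᵢ τᵢ` with `τᵢ = (i/2) σᵢ` (Pauli matrices), the standard basis of the Lie algebra of
`SU(2)`. -/
def su2 (x : Fin 3 → ℝ) : Matrix (Fin 2) (Fin 2) ℂ :=
  (Complex.I / 2) •
    !![(x 2 : ℂ), (x 0 : ℂ) - Complex.I * (x 1 : ℂ);
       (x 0 : ℂ) + Complex.I * (x 1 : ℂ), -(x 2 : ℂ)]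

end SU2

section Geometry

variable (M : Type*) [TopologicalSpace M] [ChartedSpace (EuclideanSpace ℝ (Fin 3)) M]
  [IsManifold (𝓡 3) ω M]

/-- A smooth `SU(2)` connection one-form `A = Aⁱ τᵢ` on `M`, given by its components `Aⁱ`. It is
smooth as a fibrewise linear function on the tangent bundle. -/
structure Connection where
  toFun : (p : M) → TangentSpace (𝓡 3) p →ₗ[ℝ] (Fin 3 → ℝ)
  smooth : ContMDiff (𝓡 3).tangent 𝓘(ℝ, Fin 3 → ℝ) ∞
    (fun v : TangentBundle (𝓡 3) M => toFun v.proj v.2)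

/-- An edge: an oriented compact analytic embedded arc, the restriction to `[left, right]` of a
curve which is analytic on a neighbourhood of that interval. -/
structure Edge where
  curve : ℝ → M
  left : ℝ
  right : ℝ
  left_lt_right : left < right
  analytic : ∀ t ∈ Set.Icc left right, ContMDiffAt 𝓘(ℝ, ℝ) (𝓡 3) ω curve t
  immersed : ∀ t ∈ Set.Icc left right, mfderiv 𝓘(ℝ, ℝ) (𝓡 3) curve t ≠ 0
  injective : Set.InjOn curve (Set.Icc left right)

variable {M}

/-- The velocity vector of an edge. -/
def Edge.velocity (e : Edge M) (t : ℝ) : TangentSpace (𝓡 3) (e.curve t) :=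
  mfderiv 𝓘(ℝ, ℝ) (𝓡 3) e.curve t (1 : ℝ)

section

attribute [local instance] Matrix.normedAddCommGroup Matrix.normedSpace

/-- `u t` is the parallel transport along `e` from `e left` to `e t`, that is, the path-ordered
exponential (later parameters to the left), a solution of `u' = A(e') u`, `u(left) = 1`. -/
def IsParallelTransport (A : Connection M) (e : Edge M) (u : ℝ → SU2) : Prop :=
  u e.left = 1 ∧ ∀ t ∈ Set.Icc e.left e.right,
    HasDerivWithinAt (fun s => (u s : Matrix (Fin 2) (Fin 2) ℂ))
      (su2 (A.toFun (e.curve t) (e.velocity t)) * (u t : Matrix (Fin 2) (Fin 2) ℂ))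
      (Set.Icc e.left e.right) t

open Classical in
/-- The holonomy `h_e[A]`. (The linear equation defining the parallel transport always has exactly
one solution on the interval, so that the second branch does not occur.) -/
def holonomy (A : Connection M) (e : Edge M) : SU2 :=
  if h : ∃ u, IsParallelTransport A e u then h.choose e.right else 1

/-- The holonomies along a family of edges, as a family of matrices. -/
def holonomies {J : Type} (e : J → Edge M) (A : Connection M) : J → Matrix (Fin 2) (Fin 2) ℂ :=
  fun j => (holonomy A (e j) : Matrix (Fin 2) (Fin 2) ℂ)

/-- Cylindrical functions: continuous functions of the holonomies along finitely many edges.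
(Finitely many analytic edges can be subdivided so that they meet at most in their endpoints, hence
one gets the same functions from families of edges which are graphs.) -/
def IsCylindrical (c : Connection M → ℂ) : Prop :=
  ∃ (J : Type) (_ : Fintype J) (e : J → Edge M) (g : (J → SU2) → ℂ),
    Continuous g ∧ ∀ A, c A = g (fun j => holonomy A (e j))

/-- Smooth cylindrical functions: smooth functions of the holonomies along finitely many edges. A
function on the compact submanifold `SU(2)^J` of the space of families of matrices is smooth if and
only if it is the restriction of a smooth function of matrices. -/
def IsSmoothCylindrical (c : Connection M → ℂ) : Prop :=
  ∃ (J : Type) (_ : Fintype J) (e : J → Edge M) (g : (J → Matrix (Fin 2) (Fin 2) ℂ) → ℂ),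
    ContDiff ℝ ∞ g ∧ ∀ A, c A = g (holonomies e A)

end

/-! ### Surfaces -/

/-- `φ` is an analytic local defining function, at `p`, of a hypersurface which contains `S` near
`p`. -/
def IsDefiningAt (S : Set M) (p : M) (φ : M → ℝ) : Prop :=
  ContMDiffAt (𝓡 3) 𝓘(ℝ, ℝ) ω φ p ∧ mfderiv (𝓡 3) 𝓘(ℝ, ℝ) φ p ≠ 0 ∧
    ∀ᶠ q in 𝓝 p, q ∈ S → φ q = 0

variable (M)

/-- An oriented analytic surface in `M`, possibly with (or without parts of) its edge, possibly
disconnected or empty. Near each point of its closure it is contained in an analytic hypersurface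
`{φ = 0}`, and it is two-dimensional: its points which are interior relative to the hypersurface are
dense. The (transverse) orientation is given by the two sides: for `p ∈ S`, `side p` is the germ at
`p` of the function which is `1` above, `0` on, and `-1` below the (analytically continued)
surface. -/
@[ext]
structure Surface where
  carrier : Set M
  side : (p : M) → (𝓝 p).Germ SignType
  analytic : ∀ p ∈ closure carrier, ∃ φ : M → ℝ, IsDefiningAt carrier p φ ∧
    p ∈ closure {q | q ∈ carrier ∧ ∀ᶠ x in 𝓝 q, φ x = 0 → x ∈ carrier}
  side_of_mem : ∀ p ∈ carrier, ∃ φ : M → ℝ, IsDefiningAt carrier p φ ∧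
    ∀ᶠ q in 𝓝 p, q ∈ carrier →
      side q = ((fun x => SignType.sign (φ x) : M → SignType) : (𝓝 q).Germ SignType)
  side_of_notMem : ∀ p, p ∉ carrier → side p = ((fun _ => 0 : M → SignType) : (𝓝 p).Germ SignType)

variable {M}

/-- A smooth (co-)vector field `f = (f_i)` on the surface `S` (with values in the dual of the Lie
algebra of `SU(2)`), continued by zero outside of `S`. -/
@[ext]
structure CovectorField (S : Surface M) where
  toFun : M → (Fin 3 → ℝ)
  zero_off : ∀ p, p ∉ S.carrier → toFun p = 0
  smooth : ∃ (U : Set M) (g : M → (Fin 3 → ℝ)), IsOpen U ∧ S.carrier ⊆ U ∧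
    ContMDiffOn (𝓡 3) 𝓘(ℝ, Fin 3 → ℝ) ∞ g U ∧ Set.EqOn toFun g S.carrier

/-- The half-edge of the curve `γ` at the parameter `t` in the direction `l` (`𝓝[>] t` or `𝓝[<] t`)
lies on the side `x` of `S`. -/
def LiesOn (S : Surface M) (x : SignType) (γ : ℝ → M) (t : ℝ) (l : Filter ℝ) : Prop :=
  ∃ s : M → SignType, S.side (γ t) = (s : (𝓝 (γ t)).Germ SignType) ∧ ∀ᶠ r in l, s (γ r) = x

open Classical in
/-- The number `κ(e_p)`: `1` if the half-edge starts at a point of `S` and lies above `S`, `-1` if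
it lies below `S`, and `0` otherwise. -/
def kappa (S : Surface M) (γ : ℝ → M) (t : ℝ) (l : Filter ℝ) : ℝ :=
  if LiesOn S 1 γ t l then 1 else if LiesOn S (-1) γ t l then -1 else 0

/-- The edge `e` is adapted to `S`: it meets `S` only in its endpoints and in points where it is
tangential to `S` (it runs inside the hypersurface which contains `S`). -/
def IsAdapted (S : Surface M) (e : Edge M) : Prop :=
  ∀ t ∈ Set.Ioo e.left e.right, e.curve t ∈ S.carrier →
    ∃ φ : M → ℝ, IsDefiningAt S.carrier (e.curve t) φ ∧ ∀ᶠ s in 𝓝 t, φ (e.curve s) = 0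

/-! ### The relations between fluxes -/

/-- `f'' = f + f'`. -/
def IsSum {S : Surface M} (f f' f'' : CovectorField S) : Prop :=
  ∀ p, f''.toFun p = f.toFun p + f'.toFun p

/-- `f' = r f`. -/
def IsMultiple {S : Surface M} (r : ℝ) (f f' : CovectorField S) : Prop :=
  ∀ p, f'.toFun p = r • f.toFun p

/-- `S₁ = S \ S'` with the restriction `f₁` of `f` and the orientation of `S`, `S₂ = S' \ S` with
the restriction `f₂` of `f'` and the orientation of `S'`, and `S₃ = S ∩ S'` with the orientation of
`S` and with `f₃ = f ± f'`, where the sign is the relative orientation of `S` and `S'`. -/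
structure IsCut {S S' S₁ S₂ S₃ : Surface M} (f : CovectorField S) (f' : CovectorField S')
    (f₁ : CovectorField S₁) (f₂ : CovectorField S₂) (f₃ : CovectorField S₃) : Prop where
  carrier₁ : S₁.carrier = S.carrier \ S'.carrier
  carrier₂ : S₂.carrier = S'.carrier \ S.carrier
  carrier₃ : S₃.carrier = S.carrier ∩ S'.carrier
  eq₁ : ∀ p ∈ S₁.carrier, S₁.side p = S.side p ∧ f₁.toFun p = f.toFun p
  eq₂ : ∀ p ∈ S₂.carrier, S₂.side p = S'.side p ∧ f₂.toFun p = f'.toFun p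
  eq₃ : ∀ p ∈ S₃.carrier, S₃.side p = S.side p ∧
    ((S'.side p = S.side p ∧ f₃.toFun p = f.toFun p + f'.toFun p) ∨
     (S'.side p = -S.side p ∧ f₃.toFun p = f.toFun p - f'.toFun p))

/-- The linear relations between quantities `Φ_{S,f}` labelled by surfaces `S` and co-vector fields
`f` on `S`: linearity in `f`, and
`Φ_{S,f} + Φ_{S',f'} = Φ_{S \ S',f} + Φ_{S' \ S,f'} + Φ_{S ∩ S',f ± f'}` whenever the sets on the
right are surfaces. -/
structure SatisfiesFluxRelations {V : Type*} [AddCommGroup V] [Module ℂ V]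
    (Φ : (S : Surface M) → CovectorField S → V) : Prop where
  add : ∀ (S : Surface M) (f f' f'' : CovectorField S), IsSum f f' f'' → Φ S f'' = Φ S f + Φ S f'
  smul : ∀ (S : Surface M) (r : ℝ) (f f' : CovectorField S), IsMultiple r f f' →
    Φ S f' = (r : ℂ) • Φ S f
  cut : ∀ (S S' S₁ S₂ S₃ : Surface M) (f : CovectorField S) (f' : CovectorField S')
    (f₁ : CovectorField S₁) (f₂ : CovectorField S₂) (f₃ : CovectorField S₃),
    IsCut f f' f₁ f₂ f₃ → Φ S f + Φ S' f' = Φ S₁ f₁ + Φ S₂ f₂ + Φ S₃ f₃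

end Geometry

section Cyl

variable (M : Type*) [TopologicalSpace M] [ChartedSpace (EuclideanSpace ℝ (Fin 3)) M]
  [IsManifold (𝓡 3) ω M]

/-- The bounded functions on the space of connections, with the supremum norm. -/
abbrev BoundedFun : Type _ := lp (fun _ : Connection M => ℂ) ∞

/-- The *-algebra of (bounded) cylindrical functions. -/
def cylindricalFunctions : StarSubalgebra ℂ (BoundedFun M) where
  carrier := {c | IsCylindrical (fun A => c A)}
  mul_mem' := by
    rintro a b ⟨J, hJ, e, g, hg, ha⟩ ⟨K, hK, e', g', hg', hb⟩
    refine ⟨J ⊕ K, inferInstance, Sum.elim e e',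
      fun x => g (fun j => x (Sum.inl j)) * g' (fun k => x (Sum.inr k)), ?_, ?_⟩
    · fun_prop
    · intro A
      simp [lp.infty_coeFn_mul, ha, hb]
  add_mem' := by
    rintro a b ⟨J, hJ, e, g, hg, ha⟩ ⟨K, hK, e', g', hg', hb⟩
    refine ⟨J ⊕ K, inferInstance, Sum.elim e e',
      fun x => g (fun j => x (Sum.inl j)) + g' (fun k => x (Sum.inr k)), ?_, ?_⟩
    · fun_prop
    · intro A
      simp [ha, hb]
  algebraMap_mem' := by
    intro r
    refine ⟨Empty, inferInstance, Empty.elim, fun _ => r, by fun_prop, ?_⟩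
    intro A
    rw [Algebra.algebraMap_eq_smul_one]
    simp [lp.coeFn_smul, lp.infty_coeFn_one]
  star_mem' := by
    rintro a ⟨J, hJ, e, g, hg, ha⟩
    refine ⟨J, hJ, e, fun x => star (g x), by fun_prop, ?_⟩
    intro A
    simp [ha]

/-- The C*-algebra `Cyl`, the closure of the cylindrical functions in the supremum norm. -/
def Cyl : Type _ := (cylindricalFunctions M).topologicalClosure

instance : CommCStarAlgebra (Cyl M) :=
  have : IsClosed ((cylindricalFunctions M).topologicalClosure : Set (BoundedFun M)) :=
    StarSubalgebra.isClosed_topologicalClosure _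
  inferInstanceAs (CommCStarAlgebra (cylindricalFunctions M).topologicalClosure)

variable {M} in
/-- The value `c[A]`. -/
def Cyl.eval (c : Cyl M) (A : Connection M) : ℂ := c.1 A

/-- The space of generalized connections, the spectrum of `Cyl`, with its Borel σ-algebra. -/
abbrev GenConnection : Type _ := WeakDual.characterSpace ℂ (Cyl M)

instance : MeasurableSpace (GenConnection M) := borel _

instance : BorelSpace (GenConnection M) := ⟨rfl⟩

variable {M}

/-- `c ∈ Cyl^∞`. -/
def IsSmooth (c : Cyl M) : Prop := IsSmoothCylindrical c.eval

/-- The continuous function on the space of generalized connections given by `c ∈ Cyl`. -/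
def gelfand (c : Cyl M) (χ : GenConnection M) : ℂ := χ c

section

attribute [local instance] Matrix.normedAddCommGroup Matrix.normedSpace

/-- The value at `A` of `(i l²/2) ∑_{p ∈ S ∩ γ} ∑_{e_p} κ(e_p) f_i X^i_{e_p}[g]`, where `g` is a
function of the holonomies along the edges `e j`. For the half-edge of `e j` starting at its initial
point (pointing away from `S`), `f_i X^i` is the left-invariant vector field, which generates
`h ↦ h exp(s f_i τ_i)`. For the half-edge starting at its final point (the edge is pointing towards
`S`), it is the right-invariant vector field which generates `h ↦ exp(-s f_i τ_i) h`, as it follows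
from reversing the orientation of the edge. -/
def fluxFormula (l : ℝ) {J : Type} [Fintype J] (S : Surface M) (f : CovectorField S)
    (e : J → Edge M) (g : (J → Matrix (Fin 2) (Fin 2) ℂ) → ℂ) (A : Connection M) : ℂ :=
  open Classical in
  (Complex.I * (l : ℂ) ^ 2 / 2) * ∑ j,
    ((kappa S (e j).curve (e j).left (𝓝[>] (e j).left) : ℂ) *
      deriv (fun s : ℝ => g (Function.update (holonomies e A) j
        (holonomies e A j * NormedSpace.exp (s • su2 (f.toFun ((e j).curve (e j).left)))))) 0 +
     (kappa S (e j).curve (e j).right (𝓝[<] (e j).right) : ℂ) *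
      deriv (fun s : ℝ => g (Function.update (holonomies e A) j
        (NormedSpace.exp (-(s • su2 (f.toFun ((e j).curve (e j).right)))) *
          holonomies e A j))) 0)

/-- `d = X_{S,f}[c]`, the graph of the derivation `X_{S,f}` on `Cyl^∞`: `c` is a smooth function of
the holonomies along finitely many edges adapted to `S`, and `d` is given by the formula above. -/
def IsFluxDerivative (l : ℝ) (S : Surface M) (f : CovectorField S) (c d : Cyl M) : Prop :=
  ∃ (J : Type) (_ : Fintype J) (e : J → Edge M) (g : (J → Matrix (Fin 2) (Fin 2) ℂ) → ℂ),
    (∀ j, IsAdapted S (e j)) ∧ ContDiff ℝ ∞ g ∧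
    (∀ A, c.eval A = g (holonomies e A)) ∧
    ∀ A, d.eval A = fluxFormula l S f e g A

end

/-! ### Representations -/

variable (M) in
/-- A *-representation, by operators on the Hilbert space `H`, of the *-algebra generated by `Cyl`
and by the derivations `X_{S,f} = X_{S,f}^*`: the elements of `Cyl` are represented by bounded
operators, and the fluxes by (in general unbounded) symmetric operators on a dense domain; the
commutators of fluxes and smooth cylindrical functions are represented correctly, and the fluxes
satisfy the linear relations between the `X_{S,f}`. -/
structure Representation (l : ℝ) (H : Type*) [NormedAddCommGroup H] [InnerProductSpace ℂ H]
    [CompleteSpace H] where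
  cyl : Cyl M →⋆ₐ[ℂ] (H →L[ℂ] H)
  domain : Submodule ℂ H
  flux : (S : Surface M) → CovectorField S → (domain →ₗ[ℂ] H)
  dense_domain : Dense (domain : Set H)
  symmetric : ∀ (S : Surface M) (f : CovectorField S) (v w : domain),
    inner ℂ (flux S f v) (w : H) = inner ℂ (v : H) (flux S f w)
  cyl_mem_domain : ∀ c : Cyl M, IsSmooth c → ∀ v ∈ domain, cyl c v ∈ domain
  commutator : ∀ (S : Surface M) (f : CovectorField S) (c d : Cyl M),
    IsFluxDerivative l S f c d → ∀ (v : H) (hv : v ∈ domain) (hcv : cyl c v ∈ domain),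
      flux S f ⟨cyl c v, hcv⟩ - cyl c (flux S f ⟨v, hv⟩) = cyl d v
  relations : SatisfiesFluxRelations flux

/-- The Hilbert space `⨁_ν L²(μ_ν)`. -/
abbrev DirectSumL2 {N : Type*} (μ : N → Measure (GenConnection M)) : Type _ :=
  lp (fun ν : N => Lp ℂ 2 (μ ν)) 2

theorem continuous_gelfand (c : Cyl M) : Continuous (gelfand c) :=
  (WeakDual.eval_continuous c).comp continuous_subtype_val

theorem memLp_gelfand (μ : Measure (GenConnection M)) [IsFiniteMeasure μ] (c : Cyl M) :
    MemLp (gelfand c) 2 μ := by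
  obtain ⟨C, hC⟩ := isCompact_univ.exists_bound_of_continuousOn (continuous_gelfand c).continuousOn
  exact MemLp.of_bound (continuous_gelfand c).aestronglyMeasurable C
    (Filter.Eventually.of_forall fun χ => hC χ (Set.mem_univ χ))

open Classical in
/-- The vector `I_ν(c)`. -/
def cylVector {N : Type*} (μ : N → Measure (GenConnection M)) [∀ ν, IsFiniteMeasure (μ ν)]
    (ν : N) (c : Cyl M) : DirectSumL2 μ :=
  lp.single 2 ν ((memLp_gelfand (μ ν) c).toLp (gelfand c))

/-- The space `𝔥`, the span of the vectors `I_ν(c)`, `c ∈ Cyl^∞`. -/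
def smoothVectors {N : Type*} (μ : N → Measure (GenConnection M)) [∀ ν, IsFiniteMeasure (μ ν)] :
    Submodule ℂ (DirectSumL2 μ) :=
  Submodule.span ℂ {v | ∃ (ν : N) (c : Cyl M), IsSmooth c ∧ v = cylVector μ ν c}

/-- The divergence `⟨X_{S,f}[c], c'⟩ - ⟨c, X_{S,f}[c']⟩` in `L²(μ)`, where `d = X_{S,f}[c]` and
`d' = X_{S,f}[c']`. -/
def divergence (μ : Measure (GenConnection M)) (c d c' d' : Cyl M) : ℂ :=
  (∫ χ, star (gelfand d χ) * gelfand c' χ ∂μ) - ∫ χ, star (gelfand c χ) * gelfand d' χ ∂μ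

end Cyl

end LQG

end

/-! The flux operator is prescribed on the vectors `I_ν(c)`, and the main question is whether it is
well defined: one `c` has many presentations by edges and functions, `I_ν(c)` may vanish although
`c` does not, and the spanning vectors may be linearly dependent. None of this is examined directly.
The prescription is read as a relation, `fluxGraph`, the span of the pairs of `I_ν(c)` and
`I_ν(X[c]) + c Φ_ν`, where `Φ_ν` has the components `F^{ιν}`. Hypothesis (div) makes this relation
symmetric (`inner_flux_cylVector`): between vectors of the same summand the divergence cancels
against the imaginary part of `F^{νν}`, and between different summands only the two equal complex
measures remain. A symmetric relation with dense domain is single-valued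
(`exists_linearMap_of_symmetric_graph`), hence the graph of a symmetric operator. Density of the
domain comes from Stone–Weierstrass, Gelfand duality and regularity of the measures
(`dense_smoothVectors`); the commutator is the Leibniz rule, read as an invariance of the graph
(`mem_fluxGraph_mul`).

The geometric input is that `X[c]` exists for every smooth `c`. By analyticity, an edge crosses a
surface non-tangentially in only finitely many interior points (`Edge.finite_crossings`), and
holonomies multiply under subdivision (`holonomy_split`), so `c` is a smooth function of holonomies
along adapted edges. For such edges `X` is, up to the factor `i l²/2`, the derivative along the
single vector `fluxVector` (`fluxFormula_eq_fderiv`). That vector is linear in the values of `κ f`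
at the ends of the edges, where the relations between fluxes hold pointwise (`halfEdgeCharge_cut`).
-/

noncomputable section

namespace LQG

/-! ### Linear ordinary differential equations on a compact interval -/

section LinearODE

variable {E : Type*} [NormedAddCommGroup E] [NormedSpace ℝ E]

/-- On the ball of radius `‖x‖` around `x` the field is bounded by `2K‖x‖`, so Picard–Lindelöf
applies for times up to `1/(2K)`. By linearity this time does not depend on `x`, which is what
allows iteration. -/
theorem exists_linear_ode_solution_of_short [CompleteSpace E] {A : ℝ → E →L[ℝ] E} {a b : ℝ}
    (hab : a ≤ b) {K : NNReal} (hA : ContinuousOn A (Set.Icc a b))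
    (hK : ∀ t ∈ Set.Icc a b, ‖A t‖ ≤ K) (hshort : 2 * K * (b - a) ≤ 1) (x : E) :
    ∃ u : ℝ → E, u a = x ∧
      ∀ t ∈ Set.Icc a b, HasDerivWithinAt u (A t (u t)) (Set.Icc a b) t := by
  have hP : IsPicardLindelof (fun t y => A t y) (⟨a, Set.left_mem_Icc.2 hab⟩ : Set.Icc a b) x
      ‖x‖₊ 0 (2 * K * ‖x‖₊) K := by
    refine ⟨fun t ht => ?_, fun y _ => ?_, fun t ht y hy => ?_, ?_⟩
    · exact ((A t).lipschitz.weaken (hK t ht)).lipschitzOnWith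
    · exact hA.clm_apply continuousOn_const
    · have hy' : ‖y‖ ≤ 2 * ‖x‖ := by
        have h1 : ‖y - x‖ ≤ ‖x‖ := by simpa [dist_eq_norm] using hy
        have h2 := norm_le_norm_add_norm_sub x y
        rw [norm_sub_rev] at h2
        linarith
      calc ‖A t y‖ ≤ ‖A t‖ * ‖y‖ := (A t).le_opNorm y
        _ ≤ K * (2 * ‖x‖) := mul_le_mul (hK t ht) hy' (norm_nonneg _) K.2
        _ = _ := by push_cast; ring
    · have h0 : max (b - a) (a - a) = b - a := max_eq_left (by linarith)
      simp only [h0, NNReal.coe_mul, NNReal.coe_ofNat, coe_nnnorm, NNReal.coe_zero, sub_zero]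
      calc 2 * (K : ℝ) * ‖x‖ * (b - a) = (2 * K * (b - a)) * ‖x‖ := by ring
        _ ≤ 1 * ‖x‖ := mul_le_mul_of_nonneg_right hshort (norm_nonneg _)
        _ = ‖x‖ := one_mul _
  exact hP.exists_eq_forall_mem_Icc_hasDerivWithinAt₀

/-- At the junction both one-sided derivatives are given by the same equation with the same value.
Away from a closed piece, having a derivative within it is no condition, so the two pieces can be
treated separately at every parameter and then united. -/
theorem hasDerivWithinAt_glue {A : ℝ → E → E} {a b c : ℝ} (hab : a ≤ b) (hbc : b ≤ c)
    {u v : ℝ → E} (huv : v b = u b)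
    (hu : ∀ t ∈ Set.Icc a b, HasDerivWithinAt u (A t (u t)) (Set.Icc a b) t)
    (hv : ∀ t ∈ Set.Icc b c, HasDerivWithinAt v (A t (v t)) (Set.Icc b c) t) :
    ∃ w : ℝ → E, w a = u a ∧
      ∀ t ∈ Set.Icc a c, HasDerivWithinAt w (A t (w t)) (Set.Icc a c) t := by
  classical
  let w : ℝ → E := fun t => if t ≤ b then u t else v t
  have hwu : Set.EqOn w u (Set.Icc a b) := fun t ht => if_pos ht.2
  have hwv : Set.EqOn w v (Set.Icc b c) := fun t ht => by
    rcases ht.1.eq_or_lt with rfl | h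
    · simp [w, huv]
    · exact if_neg (not_le.2 h)
  have key : ∀ t ∈ Set.Icc a c, HasDerivWithinAt w (A t (w t)) (Set.Icc a b) t ∧
      HasDerivWithinAt w (A t (w t)) (Set.Icc b c) t := by
    intro t ht
    constructor
    · by_cases h : t ≤ b
      · have hm : t ∈ Set.Icc a b := ⟨ht.1, h⟩
        rw [hwu hm]
        exact (hu t hm).congr hwu (hwu hm)
      · refine HasFDerivWithinAt.of_notMem_closure ?_
        rw [closure_Icc]
        exact fun h' => h h'.2
    · by_cases h : b ≤ t
      · have hm : t ∈ Set.Icc b c := ⟨h, ht.2⟩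
        rw [hwv hm]
        exact (hv t hm).congr hwv (hwv hm)
      · refine HasFDerivWithinAt.of_notMem_closure ?_
        rw [closure_Icc]
        exact fun h' => h h'.1
  refine ⟨w, if_pos hab, fun t ht => ?_⟩
  rw [← Set.Icc_union_Icc_eq_Icc hab hbc]
  exact (key t ht).1.union (key t ht).2

theorem exists_linear_ode_solution [CompleteSpace E] {A : ℝ → E →L[ℝ] E} {a b : ℝ}
    (hab : a ≤ b) (hA : ContinuousOn A (Set.Icc a b)) (x : E) :
    ∃ u : ℝ → E, u a = x ∧
      ∀ t ∈ Set.Icc a b, HasDerivWithinAt u (A t (u t)) (Set.Icc a b) t := by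
  obtain ⟨C, hC⟩ := isCompact_Icc.exists_bound_of_continuousOn hA
  obtain ⟨K, hK⟩ : ∃ K : NNReal, ∀ t ∈ Set.Icc a b, ‖A t‖ ≤ K :=
    ⟨C.toNNReal, fun t ht => (hC t ht).trans (Real.le_coe_toNNReal C)⟩
  obtain ⟨n, hn⟩ := exists_nat_gt (2 * K * (b - a))
  have hn0 : (0 : ℝ) < n := lt_of_le_of_lt (by have := sub_nonneg.2 hab; positivity) hn
  set δ : ℝ := (b - a) / n with hδ
  have hδ0 : 0 ≤ δ := div_nonneg (sub_nonneg.2 hab) hn0.le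
  have hnδ : a + n * δ = b := by rw [hδ]; field_simp; ring
  have hshort : 2 * K * δ ≤ 1 := by
    rw [hδ, ← mul_div_assoc, div_le_one hn0]
    exact hn.le
  have step : ∀ k : ℕ, k ≤ n → ∃ u : ℝ → E, u a = x ∧ ∀ t ∈ Set.Icc a (a + k * δ),
      HasDerivWithinAt u (A t (u t)) (Set.Icc a (a + k * δ)) t := by
    intro k
    induction k with
    | zero =>
      intro _
      obtain ⟨u, hu, hu'⟩ := exists_linear_ode_solution_of_short (le_refl a)
        (hA.mono (Set.Icc_subset_Icc_right hab))
        (fun t ht => hK t (Set.Icc_subset_Icc_right hab ht)) (by simp) x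
      exact ⟨u, hu, by simpa using hu'⟩
    | succ k ih =>
      intro hk
      obtain ⟨u, hu, hu'⟩ := ih (by omega)
      have h1 : a ≤ a + k * δ := le_add_of_nonneg_right (by positivity)
      have h2 : a + k * δ ≤ a + (k + 1 : ℕ) * δ := by push_cast; linarith
      have h3 : a + (k + 1 : ℕ) * δ ≤ b := by
        rw [← hnδ]
        have : ((k + 1 : ℕ) : ℝ) ≤ n := by exact_mod_cast hk
        gcongr
      have hsub : Set.Icc (a + k * δ) (a + (k + 1 : ℕ) * δ) ⊆ Set.Icc a b :=
        Set.Icc_subset_Icc h1 h3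
      obtain ⟨v, hv, hv'⟩ := exists_linear_ode_solution_of_short h2 (hA.mono hsub)
        (fun t ht => hK t (hsub ht))
        (by convert hshort using 2; push_cast; ring) (u (a + k * δ))
      obtain ⟨w, hw, hw'⟩ := hasDerivWithinAt_glue (A := fun t y => A t y) h1 h2 hv hu' hv'
      exact ⟨w, hw.trans hu, hw'⟩
  simpa only [hnδ] using step n le_rfl

end LinearODE

/-! ### Parallel transport and holonomies -/

section Transport

variable {M : Type*} [TopologicalSpace M] [ChartedSpace (EuclideanSpace ℝ (Fin 3)) M]

theorem Edge.continuousAt (e : Edge M) {t : ℝ} (ht : t ∈ Set.Icc e.left e.right) :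
    ContinuousAt e.curve t := (e.analytic t ht).continuousAt

variable [IsManifold (𝓡 3) ω M]

/-- The velocity is the image of the unit vector under the tangent map of the curve, which is
continuous on an open set where the curve is `C¹`; the connection is continuous on the tangent
bundle. -/
theorem Edge.continuousOn_connection (A : Connection M) (e : Edge M) :
    ContinuousOn (fun t => A.toFun (e.curve t) (e.velocity t)) (Set.Icc e.left e.right) := by
  intro t ht
  have : IsManifold (𝓡 3) 1 M := IsManifold.of_le (n := ω) le_top
  obtain ⟨U, hU, hUo, hoU⟩ : ∃ U ∈ 𝓝 t, IsOpen U ∧ ContMDiffOn 𝓘(ℝ, ℝ) (𝓡 3) 1 e.curve U := by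
    have h1 : ContMDiffAt 𝓘(ℝ, ℝ) (𝓡 3) 1 e.curve t := (e.analytic t ht).of_le le_top
    obtain ⟨u, hu, h⟩ := (contMDiffAt_iff_contMDiffOn_nhds (by simp)).1 h1
    obtain ⟨V, hVu, hVo, htV⟩ := mem_nhds_iff.1 hu
    exact ⟨V, hVo.mem_nhds htV, hVo, h.mono hVu⟩
  have h2 := hoU.continuousOn_tangentMapWithin le_rfl hUo.uniqueMDiffOn
  have h3 : ContinuousAt (tangentMapWithin 𝓘(ℝ, ℝ) (𝓡 3) e.curve U)
      (⟨t, (1 : ℝ)⟩ : TangentBundle 𝓘(ℝ, ℝ) ℝ) := by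
    refine h2.continuousAt ?_
    exact (FiberBundle.continuous_proj ℝ (TangentSpace 𝓘(ℝ, ℝ))).continuousAt.preimage_mem_nhds hU
  have h4 : Continuous (fun t : ℝ => (⟨t, (1 : ℝ)⟩ : TangentBundle 𝓘(ℝ, ℝ) ℝ)) :=
    ((tangentBundleModelSpaceHomeomorph 𝓘(ℝ, ℝ)).symm.continuous.comp
      (Continuous.prodMk continuous_id (continuous_const (y := (1 : ℝ)))) :)
  have h5 := (A.smooth.continuous.continuousAt.comp h3).comp h4.continuousAt (x := t)
  refine (h5.congr ?_).continuousWithinAt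
  filter_upwards [hU] with s hs
  simp only [Function.comp, tangentMapWithin, mfderivWithin_of_isOpen hUo hs]
  rfl

section

attribute [local instance] Matrix.linftyOpNormedRing Matrix.linftyOpNormedAlgebra

theorem star_su2 (x : Fin 3 → ℝ) : star (su2 x) = -su2 x := by
  rw [Matrix.star_eq_conjTranspose]
  ext i j
  fin_cases i <;> fin_cases j <;> simp [su2] <;> ring

/-- `su2` as a linear map. -/
def su2Linear : (Fin 3 → ℝ) →ₗ[ℝ] Matrix (Fin 2) (Fin 2) ℂ where
  toFun := su2
  map_add' x y := by
    ext i j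
    fin_cases i <;> fin_cases j <;> simp [su2] <;> ring
  map_smul' r x := by
    ext i j
    fin_cases i <;> fin_cases j <;> simp [su2] <;> ring

/-- The adjoint of matrices as a real linear map. -/
def starLinear : Matrix (Fin 2) (Fin 2) ℂ →ₗ[ℝ] Matrix (Fin 2) (Fin 2) ℂ where
  toFun := star
  map_add' := star_add
  map_smul' r x := by simp

theorem su2_add (x y : Fin 3 → ℝ) : su2 (x + y) = su2 x + su2 y := su2Linear.map_add x y

theorem su2_smul (r : ℝ) (x : Fin 3 → ℝ) : su2 (r • x) = r • su2 x := su2Linear.map_smul r x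

theorem continuous_su2 : Continuous su2 := su2Linear.continuous_of_finiteDimensional

theorem SU2.star_mul_self (u : SU2) :
    star (u : Matrix (Fin 2) (Fin 2) ℂ) * (u : Matrix (Fin 2) (Fin 2) ℂ) = 1 :=
  (Matrix.mem_unitaryGroup_iff'.1 (Matrix.mem_specialUnitaryGroup_iff.1 u.2).1)

variable {a : ℝ → Fin 3 → ℝ} {s t : ℝ} {U V : ℝ → Matrix (Fin 2) (Fin 2) ℂ}

/-- The derivative is `-U* a V + U* a V = 0`, as the values of `su2` are anti-Hermitian. Taking `V =
U` gives unitarity; taking two solutions with the same initial value gives uniqueness. -/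
theorem star_mul_const_of_transport
    (hU : ∀ r ∈ Set.Icc s t, HasDerivWithinAt U (su2 (a r) * U r) (Set.Icc s t) r)
    (hV : ∀ r ∈ Set.Icc s t, HasDerivWithinAt V (su2 (a r) * V r) (Set.Icc s t) r) :
    ∀ r ∈ Set.Icc s t, star (U r) * V r = star (U s) * V s := by
  have h : ∀ r ∈ Set.Icc s t,
      HasDerivWithinAt (fun r => star (U r) * V r) 0 (Set.Icc s t) r := by
    intro r hr
    have hstar : HasDerivWithinAt (fun r => star (U r)) (star (su2 (a r) * U r))
        (Set.Icc s t) r :=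
      (starLinear.toContinuousLinearMap.hasFDerivAt.comp_hasDerivWithinAt r (hU r hr) :)
    refine (hstar.mul (hV r hr)).congr_deriv ?_
    rw [star_mul, star_su2]
    noncomm_ring
  refine constant_of_derivWithin_zero (fun r hr => (h r hr).differentiableWithinAt) ?_
  intro r hr
  have hst : s < t := hr.1.trans_lt hr.2
  exact (h r ⟨hr.1, hr.2.le⟩).derivWithin (uniqueDiffOn_Icc hst r ⟨hr.1, hr.2.le⟩)

/-- Liouville's formula for a traceless coefficient. -/
theorem det_const_of_transport
    (hU : ∀ r ∈ Set.Icc s t, HasDerivWithinAt U (su2 (a r) * U r) (Set.Icc s t) r) :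
    ∀ r ∈ Set.Icc s t, (U r).det = (U s).det := by
  have h : ∀ r ∈ Set.Icc s t,
      HasDerivWithinAt (fun r => (U r).det) 0 (Set.Icc s t) r := by
    intro r hr
    have hentry : ∀ i j, HasDerivWithinAt (fun r => U r i j) ((su2 (a r) * U r) i j)
        (Set.Icc s t) r := fun i j =>
      ((Matrix.entryLinearMap ℝ ℂ i j).toContinuousLinearMap.hasFDerivAt.comp_hasDerivWithinAt r
        (hU r hr) :)
    simp only [Matrix.det_fin_two]
    refine (((hentry 0 0).mul (hentry 1 1)).sub ((hentry 0 1).mul (hentry 1 0))).congr_deriv ?_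
    simp [Matrix.mul_apply, su2]
    ring
  refine constant_of_derivWithin_zero (fun r hr => (h r hr).differentiableWithinAt) ?_
  intro r hr
  have hst : s < t := hr.1.trans_lt hr.2
  exact (h r ⟨hr.1, hr.2.le⟩).derivWithin (uniqueDiffOn_Icc hst r ⟨hr.1, hr.2.le⟩)

theorem IsParallelTransport.eqOn {A : Connection M} {e : Edge M} {u v : ℝ → SU2}
    (hu : IsParallelTransport A e u) (hv : IsParallelTransport A e v) :
    Set.EqOn u v (Set.Icc e.left e.right) := by
  intro t ht
  have h := star_mul_const_of_transport hu.2 hv.2 t ht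
  rw [hu.1, hv.1] at h
  simp only [OneMemClass.coe_one, star_one, mul_one] at h
  have h2 : star (v t : Matrix (Fin 2) (Fin 2) ℂ) = star (u t : Matrix (Fin 2) (Fin 2) ℂ) :=
    (left_inv_eq_right_inv h (mul_eq_one_comm.1 (SU2.star_mul_self (v t)))).symm
  exact Subtype.ext (star_injective h2.symm)

theorem exists_isParallelTransport (A : Connection M) (e : Edge M) :
    ∃ u, IsParallelTransport A e u := by
  classical
  set a : ℝ → Fin 3 → ℝ := fun t => A.toFun (e.curve t) (e.velocity t)
  have hle := e.left_lt_right.le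
  have hc : ContinuousOn (fun t => ContinuousLinearMap.mul ℝ (Matrix (Fin 2) (Fin 2) ℂ)
      (su2 (a t))) (Set.Icc e.left e.right) :=
    (ContinuousLinearMap.mul ℝ _).continuous.comp_continuousOn
      (continuous_su2.comp_continuousOn (Edge.continuousOn_connection A e))
  obtain ⟨U, hU1, hU⟩ := exists_linear_ode_solution hle hc 1
  have hU' : ∀ r ∈ Set.Icc e.left e.right,
      HasDerivWithinAt U (su2 (a r) * U r) (Set.Icc e.left e.right) r := hU
  have hmem : ∀ r ∈ Set.Icc e.left e.right, U r ∈ Matrix.specialUnitaryGroup (Fin 2) ℂ := by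
    intro r hr
    refine Matrix.mem_specialUnitaryGroup_iff.2 ⟨Matrix.mem_unitaryGroup_iff'.2 ?_, ?_⟩
    · rw [star_mul_const_of_transport hU' hU' r hr, hU1, star_one, one_mul]
    · rw [det_const_of_transport hU' r hr, hU1, Matrix.det_one]
  -- Off the interval `U` need not lie in `SU(2)`; the filler `1` is harmless, since only values and
  -- derivatives within the interval matter.
  let u : ℝ → SU2 := fun r => if hr : r ∈ Set.Icc e.left e.right then ⟨U r, hmem r hr⟩ else 1
  have hu : ∀ r ∈ Set.Icc e.left e.right, (u r : Matrix (Fin 2) (Fin 2) ℂ) = U r := by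
    intro r hr
    simp only [u, dif_pos hr]
  refine ⟨u, Subtype.ext ((hu _ (Set.left_mem_Icc.2 hle)).trans hU1), fun t ht => ?_⟩
  rw [hu t ht]
  exact (hU' t ht).congr hu (hu t ht)

theorem holonomy_eq {A : Connection M} {e : Edge M} {u : ℝ → SU2}
    (hu : IsParallelTransport A e u) : holonomy A e = u e.right := by
  have h : ∃ u, IsParallelTransport A e u := ⟨u, hu⟩
  rw [holonomy, dif_pos h]
  exact h.choose_spec.eqOn hu (Set.right_mem_Icc.2 e.left_lt_right.le)

/-- The part of an edge between two parameters. -/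
def Edge.restrict (e : Edge M) (a b : ℝ) (hab : a < b) (ha : e.left ≤ a) (hb : b ≤ e.right) :
    Edge M where
  curve := e.curve
  left := a
  right := b
  left_lt_right := hab
  analytic t ht := e.analytic t ⟨ha.trans ht.1, ht.2.trans hb⟩
  immersed t ht := e.immersed t ⟨ha.trans ht.1, ht.2.trans hb⟩
  injective := e.injective.mono (Set.Icc_subset_Icc ha hb)

/-- Right multiplication by a constant preserves the transport equation, so `u t * (u b)⁻¹` is the
transport starting at `b`. -/
theorem holonomy_split (A : Connection M) (e : Edge M) {b : ℝ} (hb : b ∈ Set.Ioo e.left e.right) :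
    holonomy A e =
      holonomy A (e.restrict b e.right hb.2 hb.1.le le_rfl) *
        holonomy A (e.restrict e.left b hb.1 le_rfl hb.2.le) := by
  obtain ⟨u, hu⟩ := exists_isParallelTransport A e
  have h1 : IsParallelTransport A (e.restrict e.left b hb.1 le_rfl hb.2.le) u := by
    refine ⟨hu.1, fun t ht => ?_⟩
    exact (hu.2 t ⟨ht.1, ht.2.trans hb.2.le⟩).mono (Set.Icc_subset_Icc_right hb.2.le)
  have h2 : IsParallelTransport A (e.restrict b e.right hb.2 hb.1.le le_rfl)
      (fun t => u t * (u b)⁻¹) := by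
    refine ⟨mul_inv_cancel _, fun t ht => ?_⟩
    have h := ((hu.2 t ⟨hb.1.le.trans ht.1, ht.2⟩).mono
      (Set.Icc_subset_Icc_left hb.1.le)).mul_const (((u b)⁻¹ : SU2) : Matrix (Fin 2) (Fin 2) ℂ)
    rw [mul_assoc] at h
    exact h
  rw [holonomy_eq hu, holonomy_eq h1, holonomy_eq h2]
  simp [Edge.restrict]

end

end Transport

/-! ### Subdividing edges so that they are adapted to surfaces -/

section Subdivision

variable {M : Type*} [TopologicalSpace M] [ChartedSpace (EuclideanSpace ℝ (Fin 3)) M]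

/-- Continuity of the derivative is available only in tangent coordinates based at `p`. The
coordinate changes are the identity at `p`, so the coordinate expression is nonzero there; at nearby
points it is enough that a zero derivative has a zero expression. -/
theorem ContMDiffAt.eventually_mfderiv_ne_zero [IsManifold (𝓡 3) 1 M] {φ : M → ℝ} {p : M}
    (hφ : ContMDiffAt (𝓡 3) 𝓘(ℝ, ℝ) 1 φ p) (h : mfderiv (𝓡 3) 𝓘(ℝ, ℝ) φ p ≠ 0) :
    ∀ᶠ q in 𝓝 p, mfderiv (𝓡 3) 𝓘(ℝ, ℝ) φ q ≠ 0 := by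
  let D : M → EuclideanSpace ℝ (Fin 3) →L[ℝ] ℝ := fun q => mfderiv (𝓡 3) 𝓘(ℝ, ℝ) φ q
  have h1 : ContinuousAt (inTangentCoordinates (𝓡 3) 𝓘(ℝ, ℝ) id φ D p) p :=
    (hφ.mfderiv_const (m := 0) (by simp)).continuousAt
  have h2 : ∀ᶠ q in 𝓝 p, q ∈ (chartAt (EuclideanSpace ℝ (Fin 3)) p).source :=
    chart_source_mem_nhds _ p
  have hco : ∀ q ∈ (chartAt (EuclideanSpace ℝ (Fin 3)) p).source, _ := fun q hq =>
    inTangentCoordinates_eq (I := 𝓡 3) (I' := 𝓘(ℝ, ℝ)) id φ D (x₀ := p) (x := q) hq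
      (by rw [chartAt_self_eq]; exact Set.mem_univ _)
  have h3 : inTangentCoordinates (𝓡 3) 𝓘(ℝ, ℝ) id φ D p p ≠ 0 := by
    intro h0
    suffices hD : D p = 0 from h hD
    rw [hco p (mem_chart_source _ p)] at h0
    refine ContinuousLinearMap.ext fun v => ?_
    have h6 := (tangentBundleCore (𝓡 3) M).coordChange_self _ _ (mem_achart_source _ p) v
    have h7 := (tangentBundleCore 𝓘(ℝ, ℝ) ℝ).coordChange_self _ _ (mem_achart_source _ (φ p))
      (D p v)
    have h4 := DFunLike.congr_fun h0 v
    rw [ContinuousLinearMap.comp_apply, ContinuousLinearMap.comp_apply] at h4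
    exact h7.symm.trans ((congrArg
      (fun w => (tangentBundleCore 𝓘(ℝ, ℝ) ℝ).coordChange _ _ _ (D p w)) h6.symm).trans h4)
  filter_upwards [h1.eventually_ne h3, h2] with q hq hq2 h0
  apply hq
  have h5 : D q = 0 := h0
  rw [hco q hq2, h5, ContinuousLinearMap.zero_comp, ContinuousLinearMap.comp_zero]

theorem IsDefiningAt.eventually [IsManifold (𝓡 3) ω M] {S : Set M} {p : M} {φ : M → ℝ}
    (h : IsDefiningAt S p φ) : ∀ᶠ q in 𝓝 p, IsDefiningAt S q φ := by
  have : IsManifold (𝓡 3) 1 M := IsManifold.of_le (n := ω) le_top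
  filter_upwards [(contMDiffAt_iff_contMDiffAt_nhds (by simp)).1 h.1,
    ContMDiffAt.eventually_mfderiv_ne_zero (h.1.of_le le_top) h.2.1,
    eventually_eventually_nhds.2 h.2.2] with q h1 h2 h3
  exact ⟨h1, h2, h3⟩

/-- The curve `γ` runs, near the parameter `t`, inside a hypersurface which contains `S`. -/
def IsTangentialAt (S : Surface M) (γ : ℝ → M) (t : ℝ) : Prop :=
  ∃ φ : M → ℝ, IsDefiningAt S.carrier (γ t) φ ∧ ∀ᶠ s in 𝓝 t, φ (γ s) = 0

/-- The parameters of interior points of the edge in which it meets `S` without being tangential. -/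
def Edge.crossings (S : Surface M) (e : Edge M) : Set ℝ :=
  {t | t ∈ Set.Ioo e.left e.right ∧ e.curve t ∈ S.carrier ∧ ¬ IsTangentialAt S e.curve t}

theorem isAdapted_iff {S : Surface M} {e : Edge M} : IsAdapted S e ↔ e.crossings S = ∅ := by
  simp only [Set.eq_empty_iff_forall_notMem, Edge.crossings, Set.mem_ofPred_eq, not_and, not_not]
  rfl

/-- Near a parameter `t` whose point is in the closure of `S`, compose the curve with a local
defining function `φ`. The composite is analytic: either it vanishes near `t`, and then `φ` shows
that the curve is tangential wherever it meets `S` nearby, or `t` is the only possible zero nearby.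
Compactness of the interval gives finiteness; this needs defining functions on the closure of `S`,
not just on `S`. -/
theorem Edge.finite_crossings [IsManifold (𝓡 3) ω M] (S : Surface M) (e : Edge M) :
    (e.crossings S).Finite := by
  have key : (Set.Icc e.left e.right ∩ e.crossings S).Finite := by
    refine isCompact_Icc.induction_on (p := fun s => (s ∩ e.crossings S).Finite) (by simp)
      (fun s t hst ht => ht.subset (Set.inter_subset_inter_left _ hst))
      (fun s t hs ht => by rw [Set.union_inter_distrib_right]; exact hs.union ht) ?_
    intro t ht
    suffices h : ∀ᶠ s in 𝓝 t, s ∈ e.crossings S → s = t by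
      exact ⟨{s | s ∈ e.crossings S → s = t}, mem_nhdsWithin_of_mem_nhds h,
        (Set.finite_singleton t).subset fun s hs => hs.1 hs.2⟩
    have hcont := e.continuousAt ht
    by_cases hcl : e.curve t ∈ closure S.carrier
    · obtain ⟨φ, hφ, -⟩ := S.analytic _ hcl
      have han : AnalyticAt ℝ (fun s => φ (e.curve s)) t :=
        (contMDiffAt_iff_contDiffAt.1
          (ContMDiffAt.comp t hφ.1 (e.analytic t ht))).analyticAt
      rcases han.eventually_eq_zero_or_eventually_ne_zero with h0 | h0
      · filter_upwards [hcont.eventually hφ.eventually, eventually_eventually_nhds.2 h0]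
          with s hs hs0 hmem
        exact absurd ⟨φ, hs, hs0⟩ hmem.2.2
      · filter_upwards [hcont.eventually hφ.2.2, eventually_nhdsWithin_iff.1 h0]
          with s hs hs0 hmem
        by_contra hne
        exact hs0 hne (hs hmem.2.1)
    · filter_upwards [hcont.eventually (isClosed_closure.isOpen_compl.mem_nhds hcl)]
        with s hs hmem
      exact absurd (subset_closure hmem.2.1) hs
  exact key.subset fun t ht => ⟨Set.Ioo_subset_Icc_self ht.1, ht⟩

section

attribute [local instance] Matrix.normedAddCommGroup Matrix.normedSpace

/-- With the entrywise norm, matrices do not form a normed algebra, so the product is treated entry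
by entry. -/
theorem contDiff_matrix_mul {n : WithTop ℕ∞} {E : Type*} [NormedAddCommGroup E] [NormedSpace ℝ E]
    {f g : E → Matrix (Fin 2) (Fin 2) ℂ} (hf : ContDiff ℝ n f) (hg : ContDiff ℝ n g) :
    ContDiff ℝ n (fun x => f x * g x) := by
  have hentry : ∀ {h : E → Matrix (Fin 2) (Fin 2) ℂ}, ContDiff ℝ n h → ∀ i j,
      ContDiff ℝ n (fun x => h x i j) := fun hh i j => contDiff_pi.1 (contDiff_pi.1 hh i) j
  refine contDiff_pi.2 fun i => contDiff_pi.2 fun j => ?_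
  simp only [Matrix.mul_apply]
  exact ContDiff.sum fun k _ => (hentry hf i k).mul (hentry hg k j)

variable [IsManifold (𝓡 3) ω M]

/-- Edges can be subdivided into edges adapted to finitely many surfaces. -/
theorem Edge.exists_adapted_subdivision {𝒮 : Set (Surface M)} (h𝒮 : 𝒮.Finite) (e : Edge M) :
    ∃ (J : Type) (_ : Fintype J) (e' : J → Edge M)
      (P : (J → Matrix (Fin 2) (Fin 2) ℂ) → Matrix (Fin 2) (Fin 2) ℂ),
      (∀ j, ∀ S ∈ 𝒮, IsAdapted S (e' j)) ∧ ContDiff ℝ ∞ P ∧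
        ∀ A, (holonomy A e : Matrix (Fin 2) (Fin 2) ℂ) = P (holonomies e' A) := by
  have hfin : ∀ e : Edge M, (⋃ S ∈ 𝒮, e.crossings S).Finite := fun e =>
    h𝒮.biUnion fun S _ => e.finite_crossings S
  induction h : (⋃ S ∈ 𝒮, e.crossings S).ncard using Nat.strong_induction_on generalizing e with
  | _ n ih =>
    rcases (⋃ S ∈ 𝒮, e.crossings S).eq_empty_or_nonempty with h0 | ⟨b, hb⟩
    · refine ⟨Unit, inferInstance, fun _ => e, fun x => x (), fun _ S hS => ?_,
        contDiff_apply ℝ _ (), fun A => rfl⟩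
      rw [isAdapted_iff]
      simp only [Set.iUnion_eq_empty] at h0
      exact h0 S hS
    · have hbI : b ∈ Set.Ioo e.left e.right := by
        simp only [Set.mem_iUnion] at hb
        obtain ⟨S, -, hS⟩ := hb
        exact hS.1
      -- Induction on the number of crossings with all the surfaces together: after cutting at `b`,
      -- this parameter is an endpoint of both halves and no longer counts.
      have hsub : ∀ e₁ : Edge M, e₁.curve = e.curve → e.left ≤ e₁.left → e₁.right ≤ e.right →
          b ∉ Set.Ioo e₁.left e₁.right → (⋃ S ∈ 𝒮, e₁.crossings S).ncard < n := by
        intro e₁ h1 h2 h3 h4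
        rw [← h]
        refine Set.ncard_lt_ncard ⟨?_, fun hh => ?_⟩ (hfin e)
        · refine Set.iUnion₂_mono fun S _ t ht => ?_
          exact ⟨⟨h2.trans_lt ht.1.1, ht.1.2.trans_le h3⟩, h1 ▸ ht.2⟩
        · have := hh hb
          simp only [Set.mem_iUnion] at this
          obtain ⟨S, -, hS⟩ := this
          exact h4 hS.1
      obtain ⟨J, hJ, e₁, P, had, hP, hhol⟩ := ih _
        (hsub (e.restrict e.left b hbI.1 le_rfl hbI.2.le) rfl le_rfl hbI.2.le
          fun h => lt_irrefl _ h.2) _ rfl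
      obtain ⟨K, hK, e₂, Q, had', hQ, hhol'⟩ := ih _
        (hsub (e.restrict b e.right hbI.2 hbI.1.le le_rfl) rfl hbI.1.le le_rfl
          fun h => lt_irrefl _ h.1) _ rfl
      refine ⟨J ⊕ K, inferInstance, Sum.elim e₁ e₂,
        fun x => Q (fun k => x (Sum.inr k)) * P (fun j => x (Sum.inl j)), ?_, ?_, ?_⟩
      · rintro (j | k)
        exacts [had j, had' k]
      · exact contDiff_matrix_mul (hQ.comp (contDiff_pi.2 fun k => contDiff_apply ℝ _ _))
          (hP.comp (contDiff_pi.2 fun j => contDiff_apply ℝ _ _))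
      · intro A
        rw [holonomy_split A e hbI]
        exact congrArg₂ (· * ·) (hhol' A) (hhol A)

/-- Several surfaces are allowed at once because a relation between fluxes through different
surfaces is compared on one common family of edges. -/
theorem IsSmoothCylindrical.exists_adapted {𝒮 : Set (Surface M)} (h𝒮 : 𝒮.Finite)
    {c : Connection M → ℂ} (hc : IsSmoothCylindrical c) :
    ∃ (J : Type) (_ : Fintype J) (e : J → Edge M) (g : (J → Matrix (Fin 2) (Fin 2) ℂ) → ℂ),
      (∀ j, ∀ S ∈ 𝒮, IsAdapted S (e j)) ∧ ContDiff ℝ ∞ g ∧ ∀ A, c A = g (holonomies e A) := by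
  obtain ⟨J, hJ, e, g, hg, hcg⟩ := hc
  choose K hK e' P had hP hhol using fun j => (e j).exists_adapted_subdivision h𝒮
  refine ⟨Σ j, K j, inferInstance, fun x => e' x.1 x.2,
    fun x => g (fun j => P j (fun k => x ⟨j, k⟩)), fun x => had x.1 x.2, ?_, fun A => ?_⟩
  · exact hg.comp (contDiff_pi.2 fun j =>
      (hP j).comp (contDiff_pi.2 fun k => contDiff_apply ℝ _ _))
  · rw [hcg A]
    exact congrArg g (funext fun j => hhol j A)

end

end Subdivision

/-! ### Compactness of `SU(2)`, which makes continuous functions of holonomies bounded -/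

section SU2Compact

theorem isCompact_specialUnitaryGroup :
    IsCompact (Matrix.specialUnitaryGroup (Fin 2) ℂ : Set (Matrix (Fin 2) (Fin 2) ℂ)) := by
  have hK : IsCompact (Set.univ.pi fun _ : Fin 2 => Set.univ.pi fun _ : Fin 2 =>
      Metric.closedBall (0 : ℂ) 1) :=
    isCompact_univ_pi fun _ => isCompact_univ_pi fun _ => isCompact_closedBall 0 1
  have hset : (Matrix.specialUnitaryGroup (Fin 2) ℂ : Set (Matrix (Fin 2) (Fin 2) ℂ)) =
      {A | star A * A = 1} ∩ {A | A.det = 1} := by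
    ext A
    simp only [SetLike.mem_coe, Matrix.mem_specialUnitaryGroup_iff, Matrix.mem_unitaryGroup_iff']
    rfl
  refine hK.of_isClosed_subset ?_ ?_
  · rw [hset]
    exact (isClosed_eq (by fun_prop) continuous_const).inter
      (isClosed_eq (continuous_id.matrix_det) continuous_const)
  · intro A hA i _ j _
    simpa using entry_norm_bound_of_unitary (Matrix.mem_specialUnitaryGroup_iff.1 hA).1 i j

instance : CompactSpace SU2 := isCompact_iff_compactSpace.1 isCompact_specialUnitaryGroup

end SU2Compact

/-! ### The derivations `X_{S,f}` and their linear relations -/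

section Flux

variable {M : Type*} [TopologicalSpace M] [ChartedSpace (EuclideanSpace ℝ (Fin 3)) M]

section Kappa

theorem LiesOn.congr_side {S S' : Surface M} {x : SignType} {γ : ℝ → M} {t : ℝ} {l : Filter ℝ}
    (h : S'.side (γ t) = S.side (γ t)) : LiesOn S' x γ t l ↔ LiesOn S x γ t l := by
  simp only [LiesOn, h]

theorem germ_neg_neg {α : Type*} {l : Filter α} (s : l.Germ SignType) : - -s = s :=
  Quotient.inductionOn s fun s =>
    (congrArg (fun s : α → SignType => (s : l.Germ SignType)) (funext fun y => neg_neg (s y)) :)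

theorem LiesOn.neg_side {S S' : Surface M} {x : SignType} {γ : ℝ → M} {t : ℝ} {l : Filter ℝ}
    (h : S'.side (γ t) = -S.side (γ t)) : LiesOn S' x γ t l → LiesOn S (-x) γ t l := by
  rintro ⟨s, hs, hx⟩
  refine ⟨-s, ?_, hx.mono fun r hr => by simp [hr]⟩
  rw [Germ.coe_neg, ← hs, h, germ_neg_neg]

theorem LiesOn.unique {S : Surface M} {x y : SignType} {γ : ℝ → M} {t : ℝ} {l : Filter ℝ}
    [l.NeBot] (hγ : Tendsto γ l (𝓝 (γ t))) (hx : LiesOn S x γ t l) (hy : LiesOn S y γ t l) :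
    x = y := by
  obtain ⟨s, hs, hx⟩ := hx
  obtain ⟨s', hs', hy⟩ := hy
  have h := hγ.eventually (Germ.coe_eq.1 (hs.symm.trans hs'))
  obtain ⟨r, h1, h2, h3⟩ := (hx.and (hy.and h)).exists
  rw [← h1, ← h2, h3]

theorem kappa_congr {S S' : Surface M} {γ : ℝ → M} {t : ℝ} {l : Filter ℝ}
    (h : S'.side (γ t) = S.side (γ t)) : kappa S' γ t l = kappa S γ t l := by
  unfold kappa
  rw [propext (LiesOn.congr_side (x := 1) h), propext (LiesOn.congr_side (x := -1) h)]

/-- The definition of `kappa` tests "above" first, so reversing the orientation requires that a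
half-edge cannot lie both above and below (`LiesOn.unique`). -/
theorem kappa_neg {S S' : Surface M} {γ : ℝ → M} {t : ℝ} {l : Filter ℝ} [l.NeBot]
    (hγ : Tendsto γ l (𝓝 (γ t))) (h : S'.side (γ t) = -S.side (γ t)) :
    kappa S' γ t l = -kappa S γ t l := by
  have h' : S.side (γ t) = -S'.side (γ t) := by
    rw [h, germ_neg_neg]
  have h1 : LiesOn S' 1 γ t l ↔ LiesOn S (-1) γ t l :=
    ⟨LiesOn.neg_side h, fun H => by simpa using LiesOn.neg_side h' H⟩
  have h2 : LiesOn S' (-1) γ t l ↔ LiesOn S 1 γ t l :=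
    ⟨fun H => by simpa using LiesOn.neg_side h H, LiesOn.neg_side h'⟩
  unfold kappa
  rw [propext h1, propext h2]
  by_cases ha : LiesOn S 1 γ t l
  · have hb : ¬ LiesOn S (-1) γ t l := fun hb => by simpa using LiesOn.unique hγ ha hb
    simp [ha, hb]
  · by_cases hb : LiesOn S (-1) γ t l <;> simp [ha, hb]

/-- The co-vector `κ f` at the parameter `t` of the curve `γ`. -/
def halfEdgeCharge (S : Surface M) (f : CovectorField S) (γ : ℝ → M) (t : ℝ) (l : Filter ℝ) :
    Fin 3 → ℝ :=
  kappa S γ t l • f.toFun (γ t)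

/-- A pointwise check in four cases: co-vector fields vanish off their surfaces, and `kappa` depends
only on the germ of sides at the point. On the intersection with opposite orientations, the sign of
`κ` matches the sign in `f - f'`. -/
theorem halfEdgeCharge_cut {S S' S₁ S₂ S₃ : Surface M} {f : CovectorField S}
    {f' : CovectorField S'} {f₁ : CovectorField S₁} {f₂ : CovectorField S₂}
    {f₃ : CovectorField S₃} (h : IsCut f f' f₁ f₂ f₃) {γ : ℝ → M} {t : ℝ} {l : Filter ℝ} [l.NeBot]
    (hγ : Tendsto γ l (𝓝 (γ t))) :
    halfEdgeCharge S f γ t l + halfEdgeCharge S' f' γ t l =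
      halfEdgeCharge S₁ f₁ γ t l + halfEdgeCharge S₂ f₂ γ t l + halfEdgeCharge S₃ f₃ γ t l := by
  unfold halfEdgeCharge
  by_cases hS : γ t ∈ S.carrier <;> by_cases hS' : γ t ∈ S'.carrier
  · have h3 : γ t ∈ S₃.carrier := by rw [h.carrier₃]; exact ⟨hS, hS'⟩
    rw [f₁.zero_off _ (by rw [h.carrier₁]; exact fun h => h.2 hS'),
      f₂.zero_off _ (by rw [h.carrier₂]; exact fun h => h.2 hS)]
    obtain ⟨hs, h4⟩ := h.eq₃ _ h3
    rw [kappa_congr hs]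
    rcases h4 with ⟨hs', hf⟩ | ⟨hs', hf⟩
    · rw [kappa_congr hs', hf]
      module
    · rw [kappa_neg hγ hs', hf]
      module
  · have h1 : γ t ∈ S₁.carrier := by rw [h.carrier₁]; exact ⟨hS, hS'⟩
    rw [f'.zero_off _ hS', f₂.zero_off _ (by rw [h.carrier₂]; exact fun h => h.2 hS),
      f₃.zero_off _ (by rw [h.carrier₃]; exact fun h => hS' h.2), (h.eq₁ _ h1).2,
      kappa_congr (h.eq₁ _ h1).1]
    module
  · have h2 : γ t ∈ S₂.carrier := by rw [h.carrier₂]; exact ⟨hS', hS⟩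
    rw [f.zero_off _ hS, f₁.zero_off _ (by rw [h.carrier₁]; exact fun h => h.2 hS'),
      f₃.zero_off _ (by rw [h.carrier₃]; exact fun h => hS h.1), (h.eq₂ _ h2).2,
      kappa_congr (h.eq₂ _ h2).1]
    module
  · rw [f.zero_off _ hS, f'.zero_off _ hS',
      f₁.zero_off _ (by rw [h.carrier₁]; exact fun h => hS h.1),
      f₂.zero_off _ (by rw [h.carrier₂]; exact fun h => hS' h.1),
      f₃.zero_off _ (by rw [h.carrier₃]; exact fun h => hS h.1)]
    module

end Kappa

section

attribute [local instance] Matrix.linftyOpNormedRing Matrix.linftyOpNormedAlgebra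

/-- The exponential is differentiated in a normed algebra, hence the operator norm here; the result
is used below with the entrywise norm, which has the same topology. -/
theorem hasDerivAt_exp_smul_matrix (X : Matrix (Fin 2) (Fin 2) ℂ) :
    HasDerivAt (fun s : ℝ => NormedSpace.exp (s • X)) X 0 := by
  have h := hasDerivAt_exp_smul_const X (0 : ℝ)
  rw [zero_smul, NormedSpace.exp_zero, one_mul] at h
  exact h

end

section

attribute [local instance] Matrix.normedAddCommGroup Matrix.normedSpace

/-- The tangent vector, at the families `h` of matrices, in whose direction the flux through `S`
derives functions of the holonomies along the edges `e`. -/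
def fluxVector (S : Surface M) (f : CovectorField S) {J : Type} (e : J → Edge M)
    (h : J → Matrix (Fin 2) (Fin 2) ℂ) : J → Matrix (Fin 2) (Fin 2) ℂ := fun j =>
  h j * su2 (halfEdgeCharge S f (e j).curve (e j).left (𝓝[>] (e j).left)) -
    su2 (halfEdgeCharge S f (e j).curve (e j).right (𝓝[<] (e j).right)) * h j

theorem deriv_comp_update {J : Type} [Fintype J] [DecidableEq J]
    {g : (J → Matrix (Fin 2) (Fin 2) ℂ) → ℂ} {h : J → Matrix (Fin 2) (Fin 2) ℂ}
    (hg : DifferentiableAt ℝ g h) {j : J} {y : ℝ → Matrix (Fin 2) (Fin 2) ℂ}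
    {Y : Matrix (Fin 2) (Fin 2) ℂ} (hy : HasDerivAt y Y 0) (hy0 : y 0 = h j) :
    deriv (fun s : ℝ => g (Function.update h j (y s))) 0 = fderiv ℝ g h (Pi.single j Y) := by
  have h1 : HasDerivAt (fun s : ℝ => Function.update h j (y s)) (Pi.single j Y) 0 := by
    refine hasDerivAt_pi.2 fun k => ?_
    by_cases hk : k = j
    · subst hk
      simp only [Function.update_self, Pi.single_eq_same]
      exact hy
    · simpa [hk] using hasDerivAt_const (0 : ℝ) (h k)
  have h2 : Function.update h j (y 0) = h := by rw [hy0, Function.update_eq_self]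
  have h3 : HasFDerivAt g (fderiv ℝ g h) (Function.update h j (y 0)) := by
    rw [h2]
    exact hg.hasFDerivAt
  exact (h3.comp_hasDerivAt (0 : ℝ) h1).deriv

theorem fluxVector_add {S : Surface M} {f f' f'' : CovectorField S} (hf : IsSum f f' f'')
    {J : Type} (e : J → Edge M) (h : J → Matrix (Fin 2) (Fin 2) ℂ) :
    fluxVector S f'' e h = fluxVector S f e h + fluxVector S f' e h := by
  ext1 j
  simp only [fluxVector, halfEdgeCharge, hf _, smul_add, su2_add, Pi.add_apply]
  noncomm_ring

theorem fluxVector_smul {S : Surface M} {r : ℝ} {f f' : CovectorField S} (hf : IsMultiple r f f')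
    {J : Type} (e : J → Edge M) (h : J → Matrix (Fin 2) (Fin 2) ℂ) :
    fluxVector S f' e h = r • fluxVector S f e h := by
  ext1 j
  simp only [fluxVector, halfEdgeCharge, hf _, smul_comm _ r, su2_smul r, Pi.smul_apply,
    mul_smul_comm, smul_mul_assoc, smul_sub]

theorem fluxVector_cut {S S' S₁ S₂ S₃ : Surface M} {f : CovectorField S}
    {f' : CovectorField S'} {f₁ : CovectorField S₁} {f₂ : CovectorField S₂}
    {f₃ : CovectorField S₃} (hc : IsCut f f' f₁ f₂ f₃)
    {J : Type} (e : J → Edge M) (h : J → Matrix (Fin 2) (Fin 2) ℂ) :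
    fluxVector S f e h + fluxVector S' f' e h =
      fluxVector S₁ f₁ e h + fluxVector S₂ f₂ e h + fluxVector S₃ f₃ e h := by
  ext1 j
  have hlt := (e j).left_lt_right
  have hL := congrArg su2 (halfEdgeCharge_cut hc (l := 𝓝[>] (e j).left)
    (((e j).continuousAt (Set.left_mem_Icc.2 hlt.le)).tendsto.mono_left nhdsWithin_le_nhds))
  have hR := congrArg su2 (halfEdgeCharge_cut hc (l := 𝓝[<] (e j).right)
    (((e j).continuousAt (Set.right_mem_Icc.2 hlt.le)).tendsto.mono_left nhdsWithin_le_nhds))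
  simp only [su2_add] at hL hR
  simp only [fluxVector, Pi.add_apply]
  rw [sub_add_sub_comm, sub_add_sub_comm, sub_add_sub_comm, ← mul_add, ← add_mul, hL, hR]
  noncomm_ring

theorem continuous_fluxVector (S : Surface M) (f : CovectorField S) {J : Type} (e : J → Edge M) :
    Continuous (fluxVector S f e) := by
  refine continuous_pi fun j => ?_
  have h : Continuous fun h : J → Matrix (Fin 2) (Fin 2) ℂ => h j := continuous_apply j
  exact (h.matrix_mul continuous_const).sub (continuous_const.matrix_mul h)

variable [IsManifold (𝓡 3) ω M]

/-- The sum of one-parameter derivatives collapses to one directional derivative. Linearity in the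
fluxes, continuity of the result and the Leibniz rule then become properties of `fderiv` and
`fluxVector`. -/
theorem fluxFormula_eq_fderiv (l : ℝ) {J : Type} [Fintype J] (S : Surface M) (f : CovectorField S)
    (e : J → Edge M) {g : (J → Matrix (Fin 2) (Fin 2) ℂ) → ℂ} (hg : ContDiff ℝ ∞ g)
    (A : Connection M) :
    fluxFormula l S f e g A = (Complex.I * (l : ℂ) ^ 2 / 2) *
      fderiv ℝ g (holonomies e A) (fluxVector S f e (holonomies e A)) := by
  classical
  set h := holonomies e A with hh
  have hd : DifferentiableAt ℝ g h := hg.differentiable (by simp) h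
  have hL : ∀ j (X : Matrix (Fin 2) (Fin 2) ℂ),
      deriv (fun s : ℝ => g (Function.update h j (h j * NormedSpace.exp (s • X)))) 0 =
        fderiv ℝ g h (Pi.single j (h j * X)) := fun j X =>
    deriv_comp_update hd
      (((LinearMap.mulLeft ℝ (h j)).toContinuousLinearMap.hasFDerivAt.comp_hasDerivAt
        (0 : ℝ) (hasDerivAt_exp_smul_matrix X)) :) (by simp)
  have hR : ∀ j (X : Matrix (Fin 2) (Fin 2) ℂ),
      deriv (fun s : ℝ => g (Function.update h j (NormedSpace.exp (-(s • X)) * h j))) 0 =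
        fderiv ℝ g h (Pi.single j (-X * h j)) := fun j X => by
    simp only [← smul_neg]
    exact deriv_comp_update hd
      (((LinearMap.mulRight ℝ (h j)).toContinuousLinearMap.hasFDerivAt.comp_hasDerivAt
        (0 : ℝ) (hasDerivAt_exp_smul_matrix (-X))) :) (by simp)
  rw [fluxFormula]
  congr 1
  have hsum : fluxVector S f e h = ∑ j, Pi.single j (fluxVector S f e h j) :=
    (Finset.univ_sum_single _).symm
  rw [hsum, map_sum]
  refine Finset.sum_congr rfl fun j _ => ?_
  have hj : fluxVector S f e h j =
      kappa S (e j).curve (e j).left (𝓝[>] (e j).left) •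
        (h j * su2 (f.toFun ((e j).curve (e j).left))) +
      kappa S (e j).curve (e j).right (𝓝[<] (e j).right) •
        (-su2 (f.toFun ((e j).curve (e j).right)) * h j) := by
    simp only [fluxVector, halfEdgeCharge, su2_smul, mul_smul_comm, smul_mul_assoc, neg_mul,
      smul_neg]
    rw [sub_eq_add_neg]
  rw [hj, Pi.single_add, Pi.single_smul, Pi.single_smul, map_add, map_smul, map_smul,
    Complex.real_smul, Complex.real_smul]
  congr 2
  · convert hL j _
  · convert hR j _

/-! ### The algebra `Cyl` -/

theorem Cyl.eval_mul (c c' : Cyl M) (A : Connection M) :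
    (c * c').eval A = c.eval A * c'.eval A := rfl

theorem Cyl.eval_add (c c' : Cyl M) (A : Connection M) :
    (c + c').eval A = c.eval A + c'.eval A := rfl

theorem Cyl.eval_smul (r : ℂ) (c : Cyl M) (A : Connection M) : (r • c).eval A = r * c.eval A := rfl

theorem Cyl.ext {c c' : Cyl M} (h : ∀ A, c.eval A = c'.eval A) : c = c' :=
  Subtype.ext (lp.ext (funext h))

/-- A continuous function of the holonomies along finitely many edges, as an element of `Cyl`. -/
theorem exists_cyl {J : Type} [Fintype J] (e : J → Edge M) {g : (J → SU2) → ℂ}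
    (hg : Continuous g) : ∃ c : Cyl M, ∀ A, c.eval A = g (fun j => holonomy A (e j)) := by
  obtain ⟨C, hC⟩ := isCompact_univ.exists_bound_of_continuousOn hg.continuousOn
  let b : BoundedFun M := ⟨fun A => g (fun j => holonomy A (e j)),
    memℓp_infty ⟨C, by rintro _ ⟨A, rfl⟩; exact hC _ (Set.mem_univ _)⟩⟩
  exact ⟨⟨b, StarSubalgebra.le_topologicalClosure _ ⟨J, inferInstance, e, g, hg, fun A => rfl⟩⟩,
    fun A => rfl⟩

theorem exists_cyl_eq_fluxFormula (l : ℝ) {J : Type} [Fintype J] (S : Surface M)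
    (f : CovectorField S) (e : J → Edge M) {g : (J → Matrix (Fin 2) (Fin 2) ℂ) → ℂ}
    (hg : ContDiff ℝ ∞ g) : ∃ d : Cyl M, ∀ A, d.eval A = fluxFormula l S f e g A := by
  have hcoe : Continuous fun (h : J → SU2) (j : J) => (h j : Matrix (Fin 2) (Fin 2) ℂ) := by
    fun_prop
  have hcont : Continuous fun h : J → Matrix (Fin 2) (Fin 2) ℂ =>
      (Complex.I * (l : ℂ) ^ 2 / 2) * fderiv ℝ g h (fluxVector S f e h) :=
    continuous_const.mul
      ((hg.continuous_fderiv (by simp)).clm_apply (continuous_fluxVector S f e))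
  obtain ⟨d, hd⟩ := exists_cyl e (hcont.comp hcoe)
  exact ⟨d, fun A => (hd A).trans (fluxFormula_eq_fderiv l S f e hg A).symm⟩

theorem IsFluxDerivative.isSmooth {l : ℝ} {S : Surface M} {f : CovectorField S} {c d : Cyl M}
    (h : IsFluxDerivative l S f c d) : IsSmooth c := by
  obtain ⟨J, hJ, e, g, -, hg, hc, -⟩ := h
  exact ⟨J, hJ, e, g, hg, hc⟩

theorem IsSmooth.exists_isFluxDerivative {c : Cyl M} (hc : IsSmooth c) (l : ℝ) (S : Surface M)
    (f : CovectorField S) : ∃ d, IsFluxDerivative l S f c d := by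
  obtain ⟨J, hJ, e, g, had, hg, hcg⟩ := hc.exists_adapted (Set.finite_singleton S)
  obtain ⟨d, hd⟩ := exists_cyl_eq_fluxFormula l S f e hg
  exact ⟨d, J, hJ, e, g, fun j => had j S rfl, hg, hcg, hd⟩

/-- Independence of `X[c]` from the presentation of `c` is not used: the derivatives are all
computed from one choice of edges and function, so that they are related exactly. -/
theorem IsSmooth.exists_isFluxDerivative_add {c : Cyl M} (hc : IsSmooth c) (l : ℝ)
    {S : Surface M} {f f' f'' : CovectorField S} (hf : IsSum f f' f'') :
    ∃ d d', IsFluxDerivative l S f c d ∧ IsFluxDerivative l S f' c d' ∧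
      IsFluxDerivative l S f'' c (d + d') := by
  obtain ⟨J, hJ, e, g, had, hg, hcg⟩ := hc.exists_adapted (Set.finite_singleton S)
  obtain ⟨d, hd⟩ := exists_cyl_eq_fluxFormula l S f e hg
  obtain ⟨d', hd'⟩ := exists_cyl_eq_fluxFormula l S f' e hg
  refine ⟨d, d', ⟨J, hJ, e, g, fun j => had j S rfl, hg, hcg, hd⟩,
    ⟨J, hJ, e, g, fun j => had j S rfl, hg, hcg, hd'⟩,
    ⟨J, hJ, e, g, fun j => had j S rfl, hg, hcg, fun A => ?_⟩⟩
  rw [Cyl.eval_add, hd, hd']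
  simp only [fluxFormula_eq_fderiv _ _ _ _ hg, fluxVector_add hf, map_add]
  ring

theorem IsSmooth.exists_isFluxDerivative_smul {c : Cyl M} (hc : IsSmooth c) (l : ℝ)
    {S : Surface M} {r : ℝ} {f f' : CovectorField S} (hf : IsMultiple r f f') :
    ∃ d, IsFluxDerivative l S f c d ∧ IsFluxDerivative l S f' c ((r : ℂ) • d) := by
  obtain ⟨J, hJ, e, g, had, hg, hcg⟩ := hc.exists_adapted (Set.finite_singleton S)
  obtain ⟨d, hd⟩ := exists_cyl_eq_fluxFormula l S f e hg
  refine ⟨d, ⟨J, hJ, e, g, fun j => had j S rfl, hg, hcg, hd⟩,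
    ⟨J, hJ, e, g, fun j => had j S rfl, hg, hcg, fun A => ?_⟩⟩
  rw [Cyl.eval_smul, hd]
  simp only [fluxFormula_eq_fderiv _ _ _ _ hg, fluxVector_smul hf, map_smul, Complex.real_smul]
  ring

/-- Here the common edges must be adapted to all five surfaces. -/
theorem IsSmooth.exists_isFluxDerivative_cut {c : Cyl M} (hc : IsSmooth c) (l : ℝ)
    {S S' S₁ S₂ S₃ : Surface M} {f : CovectorField S} {f' : CovectorField S'}
    {f₁ : CovectorField S₁} {f₂ : CovectorField S₂} {f₃ : CovectorField S₃}
    (hf : IsCut f f' f₁ f₂ f₃) :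
    ∃ d d' d₁ d₂ d₃, IsFluxDerivative l S f c d ∧ IsFluxDerivative l S' f' c d' ∧
      IsFluxDerivative l S₁ f₁ c d₁ ∧ IsFluxDerivative l S₂ f₂ c d₂ ∧
      IsFluxDerivative l S₃ f₃ c d₃ ∧ d + d' = d₁ + d₂ + d₃ := by
  obtain ⟨J, hJ, e, g, had, hg, hcg⟩ :=
    hc.exists_adapted (𝒮 := {S, S', S₁, S₂, S₃}) (Set.toFinite _)
  choose d hd using fun (S : Surface M) (f : CovectorField S) =>
    exists_cyl_eq_fluxFormula l S f e hg
  refine ⟨d S f, d S' f', d S₁ f₁, d S₂ f₂, d S₃ f₃,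
    ⟨J, hJ, e, g, fun j => had j _ (by simp), hg, hcg, hd _ _⟩,
    ⟨J, hJ, e, g, fun j => had j _ (by simp), hg, hcg, hd _ _⟩,
    ⟨J, hJ, e, g, fun j => had j _ (by simp), hg, hcg, hd _ _⟩,
    ⟨J, hJ, e, g, fun j => had j _ (by simp), hg, hcg, hd _ _⟩,
    ⟨J, hJ, e, g, fun j => had j _ (by simp), hg, hcg, hd _ _⟩, Cyl.ext fun A => ?_⟩
  simp only [Cyl.eval_add, hd, fluxFormula_eq_fderiv _ _ _ _ hg, ← mul_add, ← map_add,
    fluxVector_cut hf]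

/-- The disjoint union of the two families of edges presents the product. The flux vector acts edge
by edge, so it restricts to the flux vector of each family, and the claim is the product rule. -/
theorem IsFluxDerivative.mul {l : ℝ} {S : Surface M} {f : CovectorField S} {c d c' d' : Cyl M}
    (h : IsFluxDerivative l S f c d) (h' : IsFluxDerivative l S f c' d') :
    IsFluxDerivative l S f (c * c') (c * d' + d * c') := by
  obtain ⟨J, hJ, e, g, had, hg, hc, hd⟩ := h
  obtain ⟨K, hK, e', g', had', hg', hc', hd'⟩ := h'
  let L₁ : (J ⊕ K → Matrix (Fin 2) (Fin 2) ℂ) →L[ℝ] (J → Matrix (Fin 2) (Fin 2) ℂ) :=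
    ContinuousLinearMap.pi fun j => ContinuousLinearMap.proj (Sum.inl j)
  let L₂ : (J ⊕ K → Matrix (Fin 2) (Fin 2) ℂ) →L[ℝ] (K → Matrix (Fin 2) (Fin 2) ℂ) :=
    ContinuousLinearMap.pi fun k => ContinuousLinearMap.proj (Sum.inr k)
  have hG : ContDiff ℝ ∞ fun x => g (L₁ x) * g' (L₂ x) :=
    (hg.comp L₁.contDiff).mul (hg'.comp L₂.contDiff)
  refine ⟨J ⊕ K, inferInstance, Sum.elim e e', fun x => g (L₁ x) * g' (L₂ x), ?_, hG, ?_, ?_⟩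
  · rintro (j | k)
    exacts [had j, had' k]
  · intro A
    rw [Cyl.eval_mul, hc, hc']
    rfl
  · intro A
    set h := holonomies (Sum.elim e e') A
    have h1 : HasFDerivAt (fun x => g (L₁ x)) ((fderiv ℝ g (L₁ h)).comp L₁) h :=
      ((hg.differentiable (by simp) (L₁ h)).hasFDerivAt).comp h L₁.hasFDerivAt
    have h2 : HasFDerivAt (fun x => g' (L₂ x)) ((fderiv ℝ g' (L₂ h)).comp L₂) h :=
      ((hg'.differentiable (by simp) (L₂ h)).hasFDerivAt).comp h L₂.hasFDerivAt
    have hprod : fderiv ℝ (fun x => g (L₁ x) * g' (L₂ x)) h =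
        g (L₁ h) • (fderiv ℝ g' (L₂ h)).comp L₂ + g' (L₂ h) • (fderiv ℝ g (L₁ h)).comp L₁ :=
      (h1.fun_mul h2).fderiv
    rw [fluxFormula_eq_fderiv l S f _ hG, show holonomies (Sum.elim e e') A = h from rfl,
      hprod, Cyl.eval_add, Cyl.eval_mul,
      Cyl.eval_mul, hc, hc', hd, hd', fluxFormula_eq_fderiv l S f _ hg,
      fluxFormula_eq_fderiv l S f _ hg']
    have e1 : L₁ h = holonomies e A := rfl
    have e2 : L₂ h = holonomies e' A := rfl
    have e3 : L₁ (fluxVector S f (Sum.elim e e') h) = fluxVector S f e (holonomies e A) := rfl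
    have e4 : L₂ (fluxVector S f (Sum.elim e e') h) = fluxVector S f e' (holonomies e' A) := rfl
    simp only [add_apply, smul_apply,
      ContinuousLinearMap.comp_apply, e1, e2, e3, e4, smul_eq_mul]
    ring

end

end Flux

/-! ### Density of smooth cylindrical functions, and multiplication operators on `L²(μ)` -/

section SmoothDense

variable {M : Type*} [TopologicalSpace M] [ChartedSpace (EuclideanSpace ℝ (Fin 3)) M]
  [IsManifold (𝓡 3) ω M]

section

attribute [local instance] Matrix.normedAddCommGroup Matrix.normedSpace

/-- The smooth functions on `SU(2)^J`. -/
def smoothFunctions (J : Type) [Fintype J] : StarSubalgebra ℂ C(J → SU2, ℂ) where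
  carrier := {F | ∃ g : (J → Matrix (Fin 2) (Fin 2) ℂ) → ℂ, ContDiff ℝ ∞ g ∧
    ∀ h : J → SU2, F h = g (fun j => h j)}
  mul_mem' := by
    rintro a b ⟨g, hg, ha⟩ ⟨g', hg', hb⟩
    exact ⟨fun x => g x * g' x, hg.mul hg', fun h => by simp [ha, hb]⟩
  add_mem' := by
    rintro a b ⟨g, hg, ha⟩ ⟨g', hg', hb⟩
    exact ⟨fun x => g x + g' x, hg.add hg', fun h => by simp [ha, hb]⟩
  algebraMap_mem' r := ⟨fun _ => r, contDiff_const, fun h => rfl⟩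
  star_mem' := by
    rintro a ⟨g, hg, ha⟩
    exact ⟨fun x => star (g x), (starL' ℝ : ℂ ≃L[ℝ] ℂ).contDiff.comp hg, fun h => by simp [ha]⟩

/-- Stone–Weierstrass: the matrix entries are smooth and separate points. -/
theorem topologicalClosure_smoothFunctions (J : Type) [Fintype J] :
    (smoothFunctions J).topologicalClosure = ⊤ := by
  refine ContinuousMap.starSubalgebra_topologicalClosure_eq_top_of_separatesPoints _ ?_
  intro x y hxy
  obtain ⟨j, hj⟩ := Function.ne_iff.1 hxy
  have hj' : ∃ a b, (x j : Matrix (Fin 2) (Fin 2) ℂ) a b ≠ (y j : Matrix (Fin 2) (Fin 2) ℂ) a b := by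
    by_contra! hcon
    exact hj (Subtype.ext (Matrix.ext hcon))
  obtain ⟨a, b, hab⟩ := hj'
  refine ⟨_, ⟨⟨fun h => (h j : Matrix (Fin 2) (Fin 2) ℂ) a b, ?_⟩,
    ⟨fun h => h j a b, ?_, fun h => rfl⟩, rfl⟩, hab⟩
  · exact (continuous_subtype_val.comp (continuous_apply j)).matrix_elem a b
  · exact contDiff_pi.1 (contDiff_pi.1 (contDiff_apply ℝ (Matrix (Fin 2) (Fin 2) ℂ) j) a) b

theorem IsSmooth.mul {c c' : Cyl M} (hc : IsSmooth c) (hc' : IsSmooth c') :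
    IsSmooth (c * c') := by
  obtain ⟨J, hJ, e, g, hg, hcg⟩ := hc
  obtain ⟨K, hK, e', g', hg', hcg'⟩ := hc'
  refine ⟨J ⊕ K, inferInstance, Sum.elim e e',
    fun x => g (fun j => x (Sum.inl j)) * g' (fun k => x (Sum.inr k)), ?_, fun A => ?_⟩
  · exact (hg.comp (contDiff_pi.2 fun j => contDiff_apply ℝ _ _)).mul
      (hg'.comp (contDiff_pi.2 fun k => contDiff_apply ℝ _ _))
  · rw [Cyl.eval_mul, hcg, hcg']
    rfl

theorem dense_isSmooth : Dense {c : Cyl M | IsSmooth c} := by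
  rw [Metric.dense_iff]
  intro c r hr
  obtain ⟨b, hb, hcb⟩ : ∃ b : BoundedFun M, b ∈ cylindricalFunctions M ∧ dist c.1 b < r / 2 := by
    have hc : c.1 ∈ closure (cylindricalFunctions M : Set (BoundedFun M)) := c.2
    exact Metric.mem_closure_iff.1 hc (r / 2) (half_pos hr)
  obtain ⟨J, hJ, e, g, hg, hbg⟩ := hb
  obtain ⟨F, ⟨g', hg', hFg'⟩, hF⟩ : ∃ F ∈ smoothFunctions J,
      dist (⟨g, hg⟩ : C(J → SU2, ℂ)) F < r / 2 := by
    have hc : (⟨g, hg⟩ : C(J → SU2, ℂ)) ∈ closure (smoothFunctions J : Set C(J → SU2, ℂ)) := by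
      rw [← StarSubalgebra.topologicalClosure_coe, topologicalClosure_smoothFunctions]
      exact Set.mem_univ _
    exact Metric.mem_closure_iff.1 hc (r / 2) (half_pos hr)
  obtain ⟨c', hc'⟩ := exists_cyl e F.continuous
  refine ⟨c', ?_, J, hJ, e, g', hg', fun A => (hc' A).trans (hFg' _)⟩
  have h1 : dist b c'.1 ≤ r / 2 := by
    rw [dist_eq_norm]
    refine lp.norm_le_of_forall_le (half_pos hr).le fun A => ?_
    have h2 : (b - c'.1) A = g (fun j => holonomy A (e j)) - F (fun j => holonomy A (e j)) := by
      rw [← hc' A, ← hbg A]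
      rfl
    rw [h2, ← dist_eq_norm]
    exact (ContinuousMap.dist_apply_le_dist (f := ⟨g, hg⟩) (g := F) _).trans hF.le
  rw [Metric.mem_ball, dist_comm]
  exact (dist_triangle c.1 b c'.1).trans_lt (by linarith)

end

theorem gelfand_mul (c c' : Cyl M) (χ : GenConnection M) :
    gelfand (c * c') χ = gelfand c χ * gelfand c' χ := map_mul χ c c'

theorem gelfand_add (c c' : Cyl M) (χ : GenConnection M) :
    gelfand (c + c') χ = gelfand c χ + gelfand c' χ := map_add χ c c'

theorem gelfand_smul (r : ℂ) (c : Cyl M) (χ : GenConnection M) :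
    gelfand (r • c) χ = r * gelfand c χ := map_smul χ r c

theorem gelfand_star (c : Cyl M) (χ : GenConnection M) :
    gelfand (star c) χ = star (gelfand c χ) := map_star χ c

theorem norm_gelfand_le (c : Cyl M) (χ : GenConnection M) :
    ‖gelfand c χ‖ ≤ ‖gelfandStarTransform (Cyl M) c‖ :=
  (gelfandStarTransform (Cyl M) c).norm_coe_le_norm χ

/-- The vector in `L²(μ)` given by an element of `Cyl`. -/
def cylLp (μ : Measure (GenConnection M)) [IsFiniteMeasure μ] (c : Cyl M) : Lp ℂ 2 μ :=
  (memLp_gelfand μ c).toLp (gelfand c)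

theorem coeFn_cylLp (μ : Measure (GenConnection M)) [IsFiniteMeasure μ] (c : Cyl M) :
    cylLp μ c =ᵐ[μ] gelfand c := MemLp.coeFn_toLp _

/-- By Gelfand duality `Cyl` is all continuous functions on its spectrum, and these are dense in
`L²` of a finite regular measure; smooth elements are dense in `Cyl`. -/
theorem dense_cylLp (μ : Measure (GenConnection M)) [IsFiniteMeasure μ] [μ.Regular] :
    Dense {v : Lp ℂ 2 μ | ∃ c, IsSmooth c ∧ v = cylLp μ c} := by
  have h1 : DenseRange (ContinuousMap.toLp (E := ℂ) 2 μ ℂ) :=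
    ContinuousMap.toLp_denseRange ℂ μ ℂ (by simp)
  have h2 : DenseRange (gelfandStarTransform (Cyl M)) :=
    (gelfandStarTransform (Cyl M)).surjective.denseRange
  have hcont : Continuous (gelfandStarTransform (Cyl M)) :=
    (gelfandTransform_isometry (Cyl M)).continuous
  have h3 := (h1.comp h2 (ContinuousMap.toLp (E := ℂ) 2 μ ℂ).continuous).dense_image
    ((ContinuousMap.toLp (E := ℂ) 2 μ ℂ).continuous.comp hcont) dense_isSmooth
  refine h3.mono ?_
  rintro _ ⟨c, hc, rfl⟩
  exact ⟨c, hc, rfl⟩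

/-- Multiplication by an element of `Cyl` in `L²(μ)`. -/
def mulLp (μ : Measure (GenConnection M)) [IsFiniteMeasure μ] (c : Cyl M) (v : Lp ℂ 2 μ) :
    Lp ℂ 2 μ :=
  ((Lp.memLp v).of_le_mul (f := fun χ => gelfand c χ * v χ)
    (c := ‖gelfandStarTransform (Cyl M) c‖)
    ((continuous_gelfand c).aestronglyMeasurable.mul (Lp.aestronglyMeasurable v))
    (Eventually.of_forall fun χ => by
      rw [norm_mul]
      exact mul_le_mul_of_nonneg_right (norm_gelfand_le c χ) (norm_nonneg _))).toLp

variable (μ : Measure (GenConnection M)) [IsFiniteMeasure μ]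

theorem coeFn_mulLp (c : Cyl M) (v : Lp ℂ 2 μ) :
    mulLp μ c v =ᵐ[μ] fun χ => gelfand c χ * v χ := MemLp.coeFn_toLp _

theorem norm_mulLp_le (c : Cyl M) (v : Lp ℂ 2 μ) :
    ‖mulLp μ c v‖ ≤ ‖gelfandStarTransform (Cyl M) c‖ * ‖v‖ := by
  refine Lp.norm_le_mul_norm_of_ae_le_mul ?_
  filter_upwards [coeFn_mulLp μ c v] with χ h
  rw [h, norm_mul]
  exact mul_le_mul_of_nonneg_right (norm_gelfand_le c χ) (norm_nonneg _)

theorem mulLp_add (c : Cyl M) (v w : Lp ℂ 2 μ) :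
    mulLp μ c (v + w) = mulLp μ c v + mulLp μ c w := by
  refine Lp.ext ?_
  filter_upwards [coeFn_mulLp μ c v, coeFn_mulLp μ c w, coeFn_mulLp μ c (v + w),
    Lp.coeFn_add v w, Lp.coeFn_add (mulLp μ c v) (mulLp μ c w)] with χ h1 h2 h3 h4 h5
  rw [h3, h4, h5, Pi.add_apply, Pi.add_apply, h1, h2, mul_add]

theorem mulLp_smul (c : Cyl M) (r : ℂ) (v : Lp ℂ 2 μ) :
    mulLp μ c (r • v) = r • mulLp μ c v := by
  refine Lp.ext ?_
  filter_upwards [coeFn_mulLp μ c v, coeFn_mulLp μ c (r • v),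
    Lp.coeFn_smul r v, Lp.coeFn_smul r (mulLp μ c v)] with χ h1 h2 h3 h4
  rw [h2, h3, h4, Pi.smul_apply, Pi.smul_apply, h1, smul_eq_mul, smul_eq_mul]
  ring

theorem mulLp_mul (c c' : Cyl M) (v : Lp ℂ 2 μ) :
    mulLp μ (c * c') v = mulLp μ c (mulLp μ c' v) := by
  refine Lp.ext ?_
  filter_upwards [coeFn_mulLp μ c' v, coeFn_mulLp μ c (mulLp μ c' v), coeFn_mulLp μ (c * c') v]
    with χ h1 h2 h3
  rw [h3, h2, h1, gelfand_mul, mul_assoc]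

theorem add_mulLp (c c' : Cyl M) (v : Lp ℂ 2 μ) :
    mulLp μ (c + c') v = mulLp μ c v + mulLp μ c' v := by
  refine Lp.ext ?_
  filter_upwards [coeFn_mulLp μ c v, coeFn_mulLp μ c' v, coeFn_mulLp μ (c + c') v,
    Lp.coeFn_add (mulLp μ c v) (mulLp μ c' v)] with χ h1 h2 h3 h4
  rw [h3, h4, Pi.add_apply, h1, h2, gelfand_add, add_mul]

theorem algebraMap_mulLp (r : ℂ) (v : Lp ℂ 2 μ) :
    mulLp μ (algebraMap ℂ (Cyl M) r) v = r • v := by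
  refine Lp.ext ?_
  filter_upwards [coeFn_mulLp μ (algebraMap ℂ (Cyl M) r) v, Lp.coeFn_smul r v] with χ h1 h2
  rw [h1, h2, Algebra.algebraMap_eq_smul_one, gelfand_smul, Pi.smul_apply, smul_eq_mul]
  have h3 : gelfand (1 : Cyl M) χ = 1 := map_one χ
  rw [h3, mul_one]

theorem mulLp_cylLp (c c' : Cyl M) : mulLp μ c (cylLp μ c') = cylLp μ (c * c') := by
  refine Lp.ext ?_
  filter_upwards [coeFn_mulLp μ c (cylLp μ c'), coeFn_cylLp μ c', coeFn_cylLp μ (c * c')]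
    with χ h1 h2 h3
  rw [h1, h2, h3, gelfand_mul]

theorem cylLp_add (c c' : Cyl M) : cylLp μ (c + c') = cylLp μ c + cylLp μ c' := by
  refine Lp.ext ?_
  filter_upwards [coeFn_cylLp μ c, coeFn_cylLp μ c', coeFn_cylLp μ (c + c'),
    Lp.coeFn_add (cylLp μ c) (cylLp μ c')] with χ h1 h2 h3 h4
  rw [h3, h4, Pi.add_apply, h1, h2, gelfand_add]

theorem cylLp_smul (r : ℂ) (c : Cyl M) : cylLp μ (r • c) = r • cylLp μ c := by
  refine Lp.ext ?_
  filter_upwards [coeFn_cylLp μ c, coeFn_cylLp μ (r • c), Lp.coeFn_smul r (cylLp μ c)]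
    with χ h1 h2 h3
  rw [h2, h3, Pi.smul_apply, h1, gelfand_smul, smul_eq_mul]

theorem inner_mulLp_star (c : Cyl M) (v w : Lp ℂ 2 μ) :
    inner ℂ (mulLp μ (star c) v) w = inner ℂ v (mulLp μ c w) := by
  rw [L2.inner_def, L2.inner_def]
  refine integral_congr_ae ?_
  filter_upwards [coeFn_mulLp μ (star c) v, coeFn_mulLp μ c w] with χ h1 h2
  rw [h1, h2, gelfand_star]
  simp only [RCLike.inner_apply, map_mul, Complex.star_def, Complex.conj_conj]
  ring

theorem inner_cylLp (c : Cyl M) (v : Lp ℂ 2 μ) :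
    inner ℂ (cylLp μ c) v = ∫ χ, star (gelfand c χ) * v χ ∂μ := by
  rw [L2.inner_def]
  refine integral_congr_ae ?_
  filter_upwards [coeFn_cylLp μ c] with χ h1
  rw [h1, RCLike.inner_apply, mul_comm]
  rfl

end SmoothDense

/-! ### The representation of `Cyl` on the direct sum -/

section CylRepresentation

variable {M : Type*} [TopologicalSpace M] [ChartedSpace (EuclideanSpace ℝ (Fin 3)) M]
  [IsManifold (𝓡 3) ω M] {N : Type*} (μ : N → Measure (GenConnection M))
  [∀ ν, IsFiniteMeasure (μ ν)]

theorem memℓp_mulLp (c : Cyl M) {v : ∀ ν, Lp ℂ 2 (μ ν)} (hv : Memℓp v 2) :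
    Memℓp (fun ν => mulLp (μ ν) c (v ν)) 2 := by
  refine Memℓp.mono' (hv.const_smul (‖gelfandStarTransform (Cyl M) c‖ : ℂ)) fun ν => ?_
  rw [Pi.smul_apply, norm_smul]
  simpa using norm_mulLp_le (μ ν) c (v ν)

/-- Multiplication by an element of `Cyl` in `⨁_ν L²(μ_ν)`. -/
def mulDirectSum (c : Cyl M) : DirectSumL2 μ →L[ℂ] DirectSumL2 μ :=
  LinearMap.mkContinuous
    { toFun := fun v => ⟨fun ν => mulLp (μ ν) c (v ν), memℓp_mulLp μ c (lp.memℓp v)⟩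
      map_add' := fun v w => lp.ext (funext fun ν => mulLp_add (μ ν) c (v ν) (w ν))
      map_smul' := fun r v => lp.ext (funext fun ν => mulLp_smul (μ ν) c r (v ν)) }
    ‖gelfandStarTransform (Cyl M) c‖ fun v => by
      have h : ‖((‖gelfandStarTransform (Cyl M) c‖ : ℂ) • v : DirectSumL2 μ)‖ =
          ‖gelfandStarTransform (Cyl M) c‖ * ‖v‖ := by
        rw [norm_smul]
        simp
      rw [← h]
      refine lp.norm_mono (by simp) fun ν => ?_
      rw [lp.coeFn_smul, Pi.smul_apply, norm_smul]
      simpa using norm_mulLp_le (μ ν) c (v ν)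

@[simp]
theorem mulDirectSum_apply (c : Cyl M) (v : DirectSumL2 μ) (ν : N) :
    mulDirectSum μ c v ν = mulLp (μ ν) c (v ν) := rfl

/-- The representation of `Cyl` by multiplication operators. -/
def cylRepresentation : Cyl M →⋆ₐ[ℂ] (DirectSumL2 μ →L[ℂ] DirectSumL2 μ) where
  toFun := mulDirectSum μ
  map_one' := by
    ext1 v
    refine lp.ext (funext fun ν => ?_)
    simpa using algebraMap_mulLp (μ ν) 1 (v ν)
  map_mul' c c' := by
    ext1 v
    exact lp.ext (funext fun ν => mulLp_mul (μ ν) c c' (v ν))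
  map_zero' := by
    ext1 v
    refine lp.ext (funext fun ν => ?_)
    simpa using algebraMap_mulLp (μ ν) 0 (v ν)
  map_add' c c' := by
    ext1 v
    exact lp.ext (funext fun ν => add_mulLp (μ ν) c c' (v ν))
  commutes' r := by
    ext1 v
    exact lp.ext (funext fun ν => algebraMap_mulLp (μ ν) r (v ν))
  map_star' c := by
    rw [ContinuousLinearMap.star_eq_adjoint, ContinuousLinearMap.eq_adjoint_iff]
    intro v w
    rw [lp.inner_eq_tsum, lp.inner_eq_tsum]
    exact tsum_congr fun ν => inner_mulLp_star (μ ν) c (v ν) (w ν)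

@[simp]
theorem cylRepresentation_apply (c : Cyl M) (v : DirectSumL2 μ) (ν : N) :
    cylRepresentation μ c v ν = mulLp (μ ν) c (v ν) := rfl

open Classical in
theorem cylVector_eq (ν : N) (c : Cyl M) :
    cylVector μ ν c = lp.single 2 ν (cylLp (μ ν) c) := rfl

theorem cylVector_apply_self (ν : N) (c : Cyl M) : cylVector μ ν c ν = cylLp (μ ν) c := by
  classical
  rw [cylVector_eq]
  convert lp.single_apply_self (E := fun ν => Lp ℂ 2 (μ ν)) 2 ν (cylLp (μ ν) c)

theorem cylVector_apply_ne {ι ν : N} (h : ι ≠ ν) (c : Cyl M) : cylVector μ ν c ι = 0 := by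
  classical
  rw [cylVector_eq]
  convert lp.single_apply_ne (E := fun ν => Lp ℂ 2 (μ ν)) 2 ν (cylLp (μ ν) c) h

theorem cylVector_add (ν : N) (c c' : Cyl M) :
    cylVector μ ν (c + c') = cylVector μ ν c + cylVector μ ν c' := by
  classical
  simp only [cylVector_eq, cylLp_add]
  exact lp.single_add 2 ν _ _

theorem cylVector_smul (ν : N) (r : ℂ) (c : Cyl M) :
    cylVector μ ν (r • c) = r • cylVector μ ν c := by
  classical
  simp only [cylVector_eq, cylLp_smul]
  exact lp.single_smul 2 ν _ _

theorem cylRepresentation_cylVector (c c' : Cyl M) (ν : N) :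
    cylRepresentation μ c (cylVector μ ν c') = cylVector μ ν (c * c') := by
  refine lp.ext (funext fun ι => ?_)
  rw [cylRepresentation_apply]
  by_cases h : ι = ν
  · subst h
    rw [cylVector_apply_self, cylVector_apply_self, mulLp_cylLp]
  · rw [cylVector_apply_ne μ h, cylVector_apply_ne μ h]
    simpa using mulLp_smul (μ ι) c 0 0

theorem inner_cylVector_left (ν : N) (c : Cyl M) (v : DirectSumL2 μ) :
    inner ℂ (cylVector μ ν c) v = inner ℂ (cylLp (μ ν) c) (v ν) := by
  classical
  rw [cylVector_eq]
  convert lp.inner_single_left (𝕜 := ℂ) ν (cylLp (μ ν) c) v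

/-- A vector orthogonal to all `I_ν(c)` has every component orthogonal to a dense subset of its
summand. -/
theorem dense_smoothVectors [∀ ν, (μ ν).Regular] :
    Dense (smoothVectors μ : Set (DirectSumL2 μ)) := by
  rw [Submodule.dense_iff_topologicalClosure_eq_top, Submodule.topologicalClosure_eq_top_iff,
    Submodule.eq_bot_iff]
  intro v hv
  refine lp.ext (funext fun ν => ?_)
  refine (dense_cylLp (μ ν)).eq_zero_of_inner_right ℂ ?_
  rintro _ ⟨c, hc, rfl⟩
  rw [← inner_cylVector_left]
  exact hv _ (Submodule.subset_span ⟨ν, c, hc, rfl⟩)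

end CylRepresentation

/-- If `(v, w)` and `(v, w')` lie in `Γ`, then so does `(0, w - w')`, and symmetry makes `w - w'`
orthogonal to the dense domain. -/
theorem exists_linearMap_of_symmetric_graph {E : Type*} [NormedAddCommGroup E]
    [InnerProductSpace ℂ E] {D : Submodule ℂ E} (hD : Dense (D : Set E))
    {Γ : Submodule ℂ (E × E)} (hΓD : ∀ v, v ∈ D ↔ ∃ w, (v, w) ∈ Γ)
    (hsymm : ∀ p ∈ Γ, ∀ q ∈ Γ, inner ℂ p.2 q.1 = inner ℂ p.1 q.2) :
    ∃ T : D →ₗ[ℂ] E, ∀ (v : D) (w : E), ((v : E), w) ∈ Γ ↔ T v = w := by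
  have huniq : ∀ v w w', (v, w) ∈ Γ → (v, w') ∈ Γ → w = w' := by
    intro v w w' h h'
    have h0 := Γ.sub_mem h h'
    refine sub_eq_zero.1 (hD.eq_zero_of_inner_left ℂ fun a ha => ?_)
    obtain ⟨b, hb⟩ := (hΓD a).1 ha
    simpa [inner_sub_left] using hsymm _ h0 _ hb
  choose T hT using fun v : D => (hΓD v).1 v.2
  refine ⟨⟨⟨T, fun v w => ?_⟩, fun r v => ?_⟩, fun v w => ⟨fun h => huniq _ _ _ (hT v) h, ?_⟩⟩
  · exact huniq _ _ _ (hT (v + w)) (Γ.add_mem (hT v) (hT w))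
  · exact huniq _ _ _ (hT (r • v)) (Γ.smul_mem r (hT v))
  · rintro rfl
    exact hT v

/-- Two complex measures which agree on measurable sets integrate bounded functions equally. The
base measures differ, so the densities cannot be compared almost everywhere; simple functions and
dominated convergence are used instead. -/
theorem integral_mul_eq_of_setIntegral_eq {X : Type*} [MeasurableSpace X] {μ ν : Measure X}
    {f g : X → ℂ} (hf : Integrable f μ) (hg : Integrable g ν)
    (hfg : ∀ B, MeasurableSet B → ∫ x in B, f x ∂μ = ∫ x in B, g x ∂ν)
    {h : X → ℂ} (hh : StronglyMeasurable h) {C : ℝ} (hC : ∀ x, ‖h x‖ ≤ C) :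
    ∫ x, h x * f x ∂μ = ∫ x, h x * g x ∂ν := by
  have hint : ∀ {μ : Measure X} {f : X → ℂ} (_ : Integrable f μ) (s : SimpleFunc X ℂ),
      Integrable (fun x => s x * f x) μ := by
    intro μ f hf s
    obtain ⟨C, hC⟩ := s.exists_forall_norm_le
    exact hf.bdd_mul s.aestronglyMeasurable (Eventually.of_forall hC)
  have hsimple : ∀ s : SimpleFunc X ℂ, ∫ x, s x * f x ∂μ = ∫ x, s x * g x ∂ν := by
    intro s
    induction s using SimpleFunc.induction with
    | const c hs =>
      rename_i B
      have h1 : ∀ (u : X → ℂ), (fun x => (SimpleFunc.piecewise B hs (SimpleFunc.const X c)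
          (SimpleFunc.const X 0)) x * u x) = B.indicator fun x => c * u x := by
        intro u
        ext x
        by_cases hx : x ∈ B <;> simp [hx]
      rw [h1, h1, integral_indicator hs, integral_indicator hs, integral_const_mul,
        integral_const_mul, hfg B hs]
    | add _ h1 h2 =>
      simp only [SimpleFunc.coe_add, Pi.add_apply, add_mul]
      rw [integral_add (hint hf _) (hint hf _), integral_add (hint hg _) (hint hg _), h1, h2]
  have hlim : ∀ {μ : Measure X} {f : X → ℂ} (_ : Integrable f μ),
      Tendsto (fun n => ∫ x, hh.approxBounded C n x * f x ∂μ) atTop (𝓝 (∫ x, h x * f x ∂μ)) := by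
    intro μ f hf
    refine tendsto_integral_of_dominated_convergence (fun x => C * ‖f x‖)
      (fun n => (hint hf _).aestronglyMeasurable) (hf.norm.const_mul C) ?_ ?_
    · intro n
      refine Eventually.of_forall fun x => ?_
      rw [norm_mul]
      exact mul_le_mul_of_nonneg_right
        (hh.norm_approxBounded_le ((norm_nonneg _).trans (hC x)) n x) (norm_nonneg _)
    · exact Eventually.of_forall fun x =>
        (hh.tendsto_approxBounded_of_norm_le (hC x)).mul_const _
  exact tendsto_nhds_unique (hlim hf) (by simpa only [hsimple] using hlim hg)

/-! ### Construction of the flux operators -/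

section FluxOperators

variable {M : Type*} [TopologicalSpace M] [ChartedSpace (EuclideanSpace ℝ (Fin 3)) M]
  [IsManifold (𝓡 3) ω M] {N : Type*} (μ : N → Measure (GenConnection M))
  [∀ ν, IsFiniteMeasure (μ ν)]

theorem integrable_gelfand_mul (μ : Measure (GenConnection M)) [IsFiniteMeasure μ] (c : Cyl M)
    {v : GenConnection M → ℂ} (hv : Integrable v μ) : Integrable (fun χ => gelfand c χ * v χ) μ :=
  hv.bdd_mul (continuous_gelfand c).aestronglyMeasurable
    (Eventually.of_forall fun χ => norm_gelfand_le c χ)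

theorem inner_cylLp_cylLp (μ : Measure (GenConnection M)) [IsFiniteMeasure μ] (c c' : Cyl M) :
    inner ℂ (cylLp μ c) (cylLp μ c') = ∫ χ, star (gelfand c χ) * gelfand c' χ ∂μ := by
  rw [inner_cylLp]
  refine integral_congr_ae ?_
  filter_upwards [coeFn_cylLp μ c'] with χ h
  rw [h]

theorem inner_cylLp_mulLp (μ : Measure (GenConnection M)) [IsFiniteMeasure μ] (c c' : Cyl M)
    (v : Lp ℂ 2 μ) :
    inner ℂ (cylLp μ c) (mulLp μ c' v) = ∫ χ, gelfand (star c * c') χ * v χ ∂μ := by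
  rw [inner_cylLp]
  refine integral_congr_ae ?_
  filter_upwards [coeFn_mulLp μ c' v] with χ h
  rw [h, gelfand_mul, gelfand_star, mul_assoc]

theorem inner_mulLp_cylLp (μ : Measure (GenConnection M)) [IsFiniteMeasure μ] (c c' : Cyl M)
    (v : Lp ℂ 2 μ) :
    inner ℂ (mulLp μ c v) (cylLp μ c') = ∫ χ, gelfand (star c * c') χ * star (v χ) ∂μ := by
  rw [← inner_conj_symm, inner_cylLp_mulLp, ← integral_conj]
  refine integral_congr_ae (Eventually.of_forall fun χ => ?_)
  simp only [gelfand_mul, gelfand_star, map_mul, Complex.star_def, Complex.conj_conj]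
  ring

/-- The graph of the flux operator: the relation on `⨁_ν L²(μ_ν)` spanned by the pairs of `I_ν(c)`
and `I_ν(X_{S,f}[c]) + c Φ_ν`. -/
def fluxGraph (l : ℝ) (S : Surface M) (f : CovectorField S) (Φ : N → DirectSumL2 μ) :
    Submodule ℂ (DirectSumL2 μ × DirectSumL2 μ) :=
  Submodule.span ℂ {p | ∃ (ν : N) (c d : Cyl M), IsFluxDerivative l S f c d ∧
    p = (cylVector μ ν c, cylVector μ ν d + cylRepresentation μ c (Φ ν))}

variable {μ} {l : ℝ} {S : Surface M} {f : CovectorField S} {Φ : N → DirectSumL2 μ}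

theorem mem_smoothVectors_iff (v : DirectSumL2 μ) :
    v ∈ smoothVectors μ ↔ ∃ w, (v, w) ∈ fluxGraph μ l S f Φ := by
  constructor
  · intro hv
    induction hv using Submodule.span_induction with
    | mem v hv =>
      obtain ⟨ν, c, hc, rfl⟩ := hv
      obtain ⟨d, hd⟩ := hc.exists_isFluxDerivative l S f
      exact ⟨_, Submodule.subset_span ⟨ν, c, d, hd, rfl⟩⟩
    | zero => exact ⟨0, Submodule.zero_mem _⟩
    | add v v' _ _ h h' =>
      obtain ⟨w, hw⟩ := h
      obtain ⟨w', hw'⟩ := h'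
      exact ⟨w + w', Submodule.add_mem _ hw hw'⟩
    | smul r v _ h =>
      obtain ⟨w, hw⟩ := h
      exact ⟨r • w, Submodule.smul_mem _ r hw⟩
  · rintro ⟨w, hw⟩
    have h : fluxGraph μ l S f Φ ≤ (smoothVectors μ).comap (LinearMap.fst ℂ _ _) := by
      refine Submodule.span_le.2 ?_
      rintro _ ⟨ν, c, d, hd, rfl⟩
      exact Submodule.subset_span ⟨ν, c, hd.isSmooth, rfl⟩
    exact h hw

/-- The component `Φ ν ι` stands for `F^{ιν}`. For `ν = ι` the divergence supplies `2i Im F^{νν}`,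
exactly the defect between `F^{νν}` and its conjugate. For `ν ≠ ι` the terms with `X` lie in
orthogonal summands, and what is left is the equality of complex measures tested on `c̄ c'`. -/
theorem inner_flux_cylVector
    (hdiv : ∀ ι (c d c' d' : Cyl M),
      IsFluxDerivative l S f c d → IsFluxDerivative l S f c' d' →
      divergence (μ ι) c d c' d' = 2 * Complex.I *
        ∫ χ, star (gelfand c χ) * ((Φ ι ι χ).im : ℂ) * gelfand c' χ ∂(μ ι))
    (hdiv' : ∀ ι ν : N, ι ≠ ν → ∀ B : Set (GenConnection M), MeasurableSet B →
      ∫ χ in B, Φ ι ν χ ∂(μ ν) = ∫ χ in B, star (Φ ν ι χ) ∂(μ ι))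
    (ν ι : N) {c d c' d' : Cyl M} (hd : IsFluxDerivative l S f c d)
    (hd' : IsFluxDerivative l S f c' d') :
    inner ℂ (cylVector μ ν d + cylRepresentation μ c (Φ ν)) (cylVector μ ι c') =
      inner ℂ (cylVector μ ν c) (cylVector μ ι d' + cylRepresentation μ c' (Φ ι)) := by
  have hint : ∀ ν ι, Integrable (fun χ => Φ ν ι χ) (μ ι) := fun ν ι =>
    (Lp.memLp (Φ ν ι)).integrable one_le_two
  have hints : ∀ ν ι, Integrable (fun χ => star (Φ ν ι χ)) (μ ι) := fun ν ι =>
    Complex.conjCLE.toContinuousLinearMap.integrable_comp (hint ν ι)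
  have hR : ∀ x : DirectSumL2 μ, inner ℂ x (cylVector μ ι c') =
      inner ℂ (x ι) (cylLp (μ ι) c') := fun x => by
    rw [← inner_conj_symm, inner_cylVector_left, inner_conj_symm]
  rw [hR, inner_cylVector_left, lp.coeFn_add, lp.coeFn_add, Pi.add_apply, Pi.add_apply,
    cylRepresentation_apply, cylRepresentation_apply, inner_add_left, inner_add_right,
    inner_mulLp_cylLp, inner_cylLp_mulLp]
  by_cases h : ν = ι
  · subst h
    rw [cylVector_apply_self, cylVector_apply_self, inner_cylLp_cylLp, inner_cylLp_cylLp,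
      ← sub_eq_zero, add_sub_add_comm]
    have h1 := hdiv ν c d c' d' hd hd'
    rw [divergence] at h1
    rw [h1, ← integral_sub (integrable_gelfand_mul _ _ (hints ν ν))
      (integrable_gelfand_mul _ _ (hint ν ν)), ← integral_const_mul, ← integral_add]
    · rw [← integral_zero (GenConnection M) ℂ (μ := μ ν)]
      refine integral_congr_ae (Eventually.of_forall fun χ => ?_)
      have h2 : star (Φ ν ν χ) = Φ ν ν χ - 2 * Complex.I * ((Φ ν ν χ).im : ℂ) := by
        apply Complex.ext <;> simp
        ring
      simp only [h2, gelfand_mul, gelfand_star]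
      ring
    · have h3 : Integrable (fun χ => ((Φ ν ν χ).im : ℂ)) (μ ν) := (hint ν ν).im.ofReal
      have h4 := (integrable_gelfand_mul (μ ν) (star c * c') h3).const_mul (2 * Complex.I)
      refine h4.congr (Eventually.of_forall fun χ => ?_)
      simp only [gelfand_mul, gelfand_star]
      ring
    · exact (integrable_gelfand_mul _ _ (hints ν ν)).sub (integrable_gelfand_mul _ _ (hint ν ν))
  · rw [cylVector_apply_ne μ (Ne.symm h), cylVector_apply_ne μ h, inner_zero_left, inner_zero_right,
      zero_add, zero_add]
    exact (integral_mul_eq_of_setIntegral_eq (hint ι ν) (hints ν ι) (hdiv' ι ν (Ne.symm h))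
      (continuous_gelfand (star c * c')).stronglyMeasurable (norm_gelfand_le _)).symm

theorem fluxGraph_symmetric
    (hsymm : ∀ (ν ι : N) (c d c' d' : Cyl M), IsFluxDerivative l S f c d →
      IsFluxDerivative l S f c' d' →
      inner ℂ (cylVector μ ν d + cylRepresentation μ c (Φ ν)) (cylVector μ ι c') =
        inner ℂ (cylVector μ ν c) (cylVector μ ι d' + cylRepresentation μ c' (Φ ι))) :
    ∀ p ∈ fluxGraph μ l S f Φ, ∀ q ∈ fluxGraph μ l S f Φ, inner ℂ p.2 q.1 = inner ℂ p.1 q.2 := by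
  intro p hp q hq
  induction hp, hq using Submodule.span_induction₂ with
  | mem_mem p q hp hq =>
    obtain ⟨ν, c, d, hd, rfl⟩ := hp
    obtain ⟨ι, c', d', hd', rfl⟩ := hq
    exact hsymm ν ι c d c' d' hd hd'
  | zero_left q _ => simp
  | zero_right p _ => simp
  | add_left p p' q _ _ _ h h' =>
    rw [Prod.snd_add, Prod.fst_add, inner_add_left, inner_add_left, h, h']
  | add_right p q q' _ _ _ h h' =>
    rw [Prod.snd_add, Prod.fst_add, inner_add_right, inner_add_right, h, h']
  | smul_left r p q _ _ h => rw [Prod.smul_snd, Prod.smul_fst, inner_smul_left, inner_smul_left, h]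
  | smul_right r p q _ _ h =>
    rw [Prod.smul_snd, Prod.smul_fst, inner_smul_right, inner_smul_right, h]

theorem cylRepresentation_mem_smoothVectors {c : Cyl M} (hc : IsSmooth c) {v : DirectSumL2 μ}
    (hv : v ∈ smoothVectors μ) : cylRepresentation μ c v ∈ smoothVectors μ := by
  have h : smoothVectors μ ≤
      (smoothVectors μ).comap (cylRepresentation μ c : DirectSumL2 μ →ₗ[ℂ] DirectSumL2 μ) := by
    refine Submodule.span_le.2 ?_
    rintro _ ⟨ν, c', hc', rfl⟩
    exact Submodule.subset_span ⟨ν, c * c', hc.mul hc', cylRepresentation_cylVector μ c c' ν⟩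
  exact h hv

/-- By the Leibniz rule the map `(v, w) ↦ (c v, c w + d v)` sends generators of the graph to
generators. Once the graph is that of an operator, this is the commutation relation. -/
theorem mem_fluxGraph_mul {c d : Cyl M} (hd : IsFluxDerivative l S f c d) {v w : DirectSumL2 μ}
    (h : (v, w) ∈ fluxGraph μ l S f Φ) :
    (cylRepresentation μ c v, cylRepresentation μ c w + cylRepresentation μ d v) ∈
      fluxGraph μ l S f Φ := by
  let T : DirectSumL2 μ × DirectSumL2 μ →ₗ[ℂ] DirectSumL2 μ × DirectSumL2 μ :=
    ((cylRepresentation μ c).comp (ContinuousLinearMap.fst ℂ _ _)).toLinearMap.prod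
      ((cylRepresentation μ c).comp (ContinuousLinearMap.snd ℂ _ _) +
        (cylRepresentation μ d).comp (ContinuousLinearMap.fst ℂ _ _)).toLinearMap
  have hT : fluxGraph μ l S f Φ ≤ (fluxGraph μ l S f Φ).comap T := by
    refine Submodule.span_le.2 ?_
    rintro _ ⟨ν, c', d', hd', rfl⟩
    refine Submodule.subset_span ⟨ν, c * c', c * d' + d * c', hd.mul hd', ?_⟩
    refine Prod.ext (cylRepresentation_cylVector μ c c' ν) ?_
    change cylRepresentation μ c (cylVector μ ν d' + cylRepresentation μ c' (Φ ν)) +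
      cylRepresentation μ d (cylVector μ ν c') = _
    rw [map_add, cylRepresentation_cylVector, cylRepresentation_cylVector, map_mul, cylVector_add]
    change _ + cylRepresentation μ c (cylRepresentation μ c' (Φ ν)) + _ =
      _ + cylRepresentation μ c (cylRepresentation μ c' (Φ ν))
    abel
  exact hT h

theorem linearMap_ext_smoothVectors {T T' : smoothVectors μ →ₗ[ℂ] DirectSumL2 μ}
    (h : ∀ (ν : N) (c : Cyl M), IsSmooth c → ∀ hc : cylVector μ ν c ∈ smoothVectors μ,
      T ⟨cylVector μ ν c, hc⟩ = T' ⟨cylVector μ ν c, hc⟩) : T = T' := by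
  ext1 ⟨v, hv⟩
  induction hv using Submodule.span_induction with
  | mem v hv =>
    obtain ⟨ν, c, hc, rfl⟩ := hv
    exact h ν c hc _
  | zero => exact (map_zero T).trans (map_zero T').symm
  | add v w hv hw h h' =>
    exact (map_add T ⟨v, hv⟩ ⟨w, hw⟩).trans
      ((congrArg₂ (· + ·) h h').trans (map_add T' ⟨v, hv⟩ ⟨w, hw⟩).symm)
  | smul r v hv h =>
    exact (map_smul T r ⟨v, hv⟩).trans
      ((congrArg (r • ·) h).trans (map_smul T' r ⟨v, hv⟩).symm)

/-- It suffices to compare on the vectors `I_ν(c)`. Because `hE` holds for every admissible `d`, the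
jointly chosen derivatives may be inserted; the remaining terms are handled by `hΦ`. -/
theorem satisfiesFluxRelations_flux
    {Φ : (S : Surface M) → CovectorField S → N → DirectSumL2 μ}
    (hΦ : ∀ ν, SatisfiesFluxRelations fun S f => Φ S f ν)
    {E : (S : Surface M) → CovectorField S → (smoothVectors μ →ₗ[ℂ] DirectSumL2 μ)}
    (hE : ∀ S f ν c d, IsFluxDerivative l S f c d → ∀ hc,
      E S f ⟨cylVector μ ν c, hc⟩ = cylVector μ ν d + cylRepresentation μ c (Φ S f ν)) :
    SatisfiesFluxRelations E where
  add S f f' f'' hf := by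
    refine linearMap_ext_smoothVectors fun ν c hc hm => ?_
    obtain ⟨d, d', hd, hd', hd''⟩ := hc.exists_isFluxDerivative_add l hf
    rw [LinearMap.add_apply, hE _ _ _ _ _ hd, hE _ _ _ _ _ hd', hE _ _ _ _ _ hd'',
      (hΦ ν).add S f f' f'' hf, map_add, cylVector_add]
    abel
  smul S r f f' hf := by
    refine linearMap_ext_smoothVectors fun ν c hc hm => ?_
    obtain ⟨d, hd, hd'⟩ := hc.exists_isFluxDerivative_smul l hf
    rw [LinearMap.smul_apply, hE _ _ _ _ _ hd, hE _ _ _ _ _ hd',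
      (hΦ ν).smul S r f f' hf, map_smul, cylVector_smul, smul_add]
  cut S S' S₁ S₂ S₃ f f' f₁ f₂ f₃ hf := by
    refine linearMap_ext_smoothVectors fun ν c hc hm => ?_
    obtain ⟨d, d', d₁, d₂, d₃, hd, hd', hd₁, hd₂, hd₃, hsum⟩ := hc.exists_isFluxDerivative_cut l hf
    rw [LinearMap.add_apply, LinearMap.add_apply, LinearMap.add_apply, hE _ _ _ _ _ hd,
      hE _ _ _ _ _ hd', hE _ _ _ _ _ hd₁, hE _ _ _ _ _ hd₂, hE _ _ _ _ _ hd₃,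
      add_add_add_comm, ← cylVector_add, ← map_add, (hΦ ν).cut S S' S₁ S₂ S₃ f f' f₁ f₂ f₃ hf, hsum,
      cylVector_add, cylVector_add, map_add, map_add]
    abel

omit [∀ ν, IsFiniteMeasure (μ ν)] in
theorem satisfiesFluxRelations_directSum {Ψ : (S : Surface M) → CovectorField S → DirectSumL2 μ}
    (h : ∀ ι, SatisfiesFluxRelations fun S f => Ψ S f ι) : SatisfiesFluxRelations Ψ where
  add S f f' f'' hf := by
    refine lp.ext (funext fun ι => ?_)
    rw [lp.coeFn_add]
    exact (h ι).add S f f' f'' hf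
  smul S r f f' hf := by
    refine lp.ext (funext fun ι => ?_)
    rw [lp.coeFn_smul]
    exact (h ι).smul S r f f' hf
  cut S S' S₁ S₂ S₃ f f' f₁ f₂ f₃ hf := by
    refine lp.ext (funext fun ι => ?_)
    rw [lp.coeFn_add, lp.coeFn_add, lp.coeFn_add]
    exact (h ι).cut S S' S₁ S₂ S₃ f f' f₁ f₂ f₃ hf

theorem exists_representation [∀ ν, (μ ν).Regular]
    {Φ : (S : Surface M) → CovectorField S → N → DirectSumL2 μ}
    (hΦ : ∀ ν, SatisfiesFluxRelations fun S f => Φ S f ν)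
    (hsymm : ∀ S f, ∀ (ν ι : N) (c d c' d' : Cyl M), IsFluxDerivative l S f c d →
      IsFluxDerivative l S f c' d' →
      inner ℂ (cylVector μ ν d + cylRepresentation μ c (Φ S f ν)) (cylVector μ ι c') =
        inner ℂ (cylVector μ ν c) (cylVector μ ι d' + cylRepresentation μ c' (Φ S f ι))) :
    ∃ R : Representation M l (DirectSumL2 μ), R.cyl = cylRepresentation μ ∧
      R.domain = smoothVectors μ ∧
      ∀ S f ν c d, IsFluxDerivative l S f c d → ∀ hc : cylVector μ ν c ∈ R.domain,
        R.flux S f ⟨cylVector μ ν c, hc⟩ = cylVector μ ν d + cylRepresentation μ c (Φ S f ν) := by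
  have hΓ := fun S f => fluxGraph_symmetric (hsymm S f)
  choose E hE using fun S f => exists_linearMap_of_symmetric_graph (dense_smoothVectors μ)
    (mem_smoothVectors_iff (l := l) (S := S) (f := f) (Φ := Φ S f)) (hΓ S f)
  have hEv : ∀ S f ν c d, IsFluxDerivative l S f c d → ∀ hc,
      E S f ⟨cylVector μ ν c, hc⟩ = cylVector μ ν d + cylRepresentation μ c (Φ S f ν) :=
    fun S f ν c d hd hc => (hE S f ⟨_, hc⟩ _).1 (Submodule.subset_span ⟨ν, c, d, hd, rfl⟩)
  refine ⟨⟨cylRepresentation μ, smoothVectors μ, E, dense_smoothVectors μ,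
    fun S f v w => hΓ S f _ ((hE S f v _).2 rfl) _ ((hE S f w _).2 rfl),
    fun c hc v hv => cylRepresentation_mem_smoothVectors hc hv, fun S f c d hd v hv hcv => ?_,
    satisfiesFluxRelations_flux hΦ hEv⟩, rfl, rfl, hEv⟩
  rw [(hE S f ⟨_, hcv⟩ _).1 (mem_fluxGraph_mul hd ((hE S f ⟨v, hv⟩ _).2 rfl)),
    add_sub_cancel_left]

theorem coeFn_cylVector_add_self (ν : N) (c d : Cyl M) (Ψ : DirectSumL2 μ) :
    (cylVector μ ν d + cylRepresentation μ c Ψ : DirectSumL2 μ) ν =ᵐ[μ ν]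
      fun χ => gelfand d χ + gelfand c χ * Ψ ν χ := by
  rw [lp.coeFn_add, Pi.add_apply, cylVector_apply_self, cylRepresentation_apply]
  filter_upwards [Lp.coeFn_add (cylLp (μ ν) d) (mulLp (μ ν) c (Ψ ν)),
    coeFn_cylLp (μ ν) d, coeFn_mulLp (μ ν) c (Ψ ν)] with χ h1 h2 h3
  rw [h1, Pi.add_apply, h2, h3]

theorem coeFn_cylVector_add_ne {ι ν : N} (h : ι ≠ ν) (c d : Cyl M) (Ψ : DirectSumL2 μ) :
    (cylVector μ ν d + cylRepresentation μ c Ψ : DirectSumL2 μ) ι =ᵐ[μ ι]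
      fun χ => gelfand c χ * Ψ ι χ := by
  rw [lp.coeFn_add, Pi.add_apply, cylVector_apply_ne μ h, cylRepresentation_apply, zero_add]
  exact coeFn_mulLp (μ ι) c (Ψ ι)

end FluxOperators

end LQG

theorem proposition2 {M : Type*} [TopologicalSpace M] [T2Space M] [SecondCountableTopology M]
    [ChartedSpace (EuclideanSpace ℝ (Fin 3)) M] [IsManifold (𝓡 3) ω M]
    (l : ℝ) (hl : 0 < l)
    {N : Type*} (μ : N → Measure (LQG.GenConnection M))
    [∀ ν, IsFiniteMeasure (μ ν)] [∀ ν, (μ ν).Regular]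
    (F : (S : LQG.Surface M) → LQG.CovectorField S → (ι ν : N) → Lp ℂ 2 (μ ι))
    (hdom : ∀ S f ν, Memℓp (fun ι => F S f ι ν) 2)
    (hrep : ∀ ι ν, LQG.SatisfiesFluxRelations (fun S f => F S f ι ν))
    (hdiv : ∀ S f ι (c d c' d' : LQG.Cyl M),
      LQG.IsFluxDerivative l S f c d → LQG.IsFluxDerivative l S f c' d' →
      LQG.divergence (μ ι) c d c' d' =
        2 * Complex.I *
          ∫ χ, star (LQG.gelfand c χ) * ((F S f ι ι χ).im : ℂ) * LQG.gelfand c' χ ∂(μ ι))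
    (hdiv' : ∀ S f (ι ν : N), ι ≠ ν → ∀ B : Set (LQG.GenConnection M), MeasurableSet B →
      ∫ χ in B, F S f ν ι χ ∂(μ ν) = ∫ χ in B, star (F S f ι ν χ) ∂(μ ι)) :
    ∃ R : LQG.Representation M l (LQG.DirectSumL2 μ),
      (∀ (c : LQG.Cyl M) (v : LQG.DirectSumL2 μ) (ι : N),
        R.cyl c v ι =ᵐ[μ ι] fun χ => LQG.gelfand c χ * v ι χ) ∧
      R.domain = LQG.smoothVectors μ ∧
      (∀ (S : LQG.Surface M) (f : LQG.CovectorField S) (c : LQG.Cyl M), LQG.IsSmooth c →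
        ∃ d, LQG.IsFluxDerivative l S f c d) ∧
      (∀ (S : LQG.Surface M) (f : LQG.CovectorField S) (ν : N) (c d : LQG.Cyl M),
        LQG.IsFluxDerivative l S f c d → ∀ (hc : LQG.cylVector μ ν c ∈ R.domain),
          (R.flux S f ⟨LQG.cylVector μ ν c, hc⟩ ν =ᵐ[μ ν] fun χ =>
            LQG.gelfand d χ + LQG.gelfand c χ * F S f ν ν χ) ∧
          ∀ ι, ι ≠ ν → R.flux S f ⟨LQG.cylVector μ ν c, hc⟩ ι =ᵐ[μ ι] fun χ =>
            LQG.gelfand c χ * F S f ι ν χ) := by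
  -- The `ν`-th column of the matrix `F`; (dom) says precisely that it is a vector of the direct
  -- sum.
  let Φ : (S : LQG.Surface M) → LQG.CovectorField S → N → LQG.DirectSumL2 μ :=
    fun S f ν => ⟨fun ι => F S f ι ν, hdom S f ν⟩
  have hΦ : ∀ ν, LQG.SatisfiesFluxRelations fun S f => Φ S f ν := fun ν =>
    LQG.satisfiesFluxRelations_directSum fun ι => hrep ι ν
  have hsymm := fun (S : LQG.Surface M) (f : LQG.CovectorField S) =>
    LQG.inner_flux_cylVector (Φ := Φ S f) (hdiv S f) (hdiv' S f)
  obtain ⟨R, hcyl, hD, hflux⟩ := LQG.exists_representation hΦ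
    fun S f ν ι c d c' d' hd hd' => hsymm S f ν ι hd hd'
  refine ⟨R, fun c v ι => ?_, hD, fun S f c hc => hc.exists_isFluxDerivative l S f,
    fun S f ν c d hd hc => ⟨?_, fun ι hι => ?_⟩⟩
  · rw [hcyl]
    exact LQG.coeFn_mulLp (μ ι) c (v ι)
  · rw [hflux S f ν c d hd hc]
    exact LQG.coeFn_cylVector_add_self ν c d _
  · rw [hflux S f ν c d hd hc]
    exact LQG.coeFn_cylVector_add_ne hι c d _

end
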